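/- Let $p$ be a prime and $N\ge 4$ an integer, and put $T=\{2,\ldots,N-2\}$ and $D=2(N-3)+\frac{(N-3)(N-4)}{2}$. Let $\mathbb{C}^D$ be the space of families $\boldsymbol{s}$ of complex numbers $s_{1i}$, $s_{(N-1)i}$ ($i\in T$) and $s_{ij}$ ($i,j\in T$, $i<j$). The $p$-adic open string $N$-point zeta function is $$Z^{(N)}(\boldsymbol{s})=\int_{\mathbb{Q}_p^{N-3}\smallsetminus\Lambda}\ \prod_{i=2}^{N-2}|x_i|_p^{s_{1i}}\,|1-x_i|_p^{s_{(N-1)i}}\prod_{2\le i<j\le N-2}|x_i-x_j|_p^{s_{ij}}\ \prod_{i=2}^{N-2}dx_i ,$$ where $dx_i$ is the Haar measure of $\mathbb{Q}_p$ with $\int_{\mathbb{Z}_p}dx_i=1$, and $\Lambda$ is the zero set of $\prod_{i}x_i(1-x_i)\prod_{i<j}(x_i-x_j)$. Let $H(\mathbb{C})\subseteq\mathbb{C}^D$ be the set of all $\boldsymbol{s}$ that satisfy * $|J|+\sum_{i\in J}\operatorname{Re}(s_{1i}+s_{(N-1)i})+\sum_{i<j,\ i\in J}\operatorname{Re}(s_{ij})+\sum_{i<j,\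 i\in T\smallsetminus J,\ j\in J}\operatorname{Re}(s_{ij})<0$ for every non-empty $J\subseteq T$; * $|K|-1+\sum_{i<j,\ i,j\in K}\operatorname{Re}(s_{ij})>0$ for every $K\subseteq T$ with $|K|\ge 2$ (for $K=\{i,j\}$ this is $1+\operatorname{Re}(s_{ij})>0$); * $|J|+\sum_{i\in J}\operatorname{Re}(s_{ti})+\sum_{i<j,\ i,j\in J}\operatorname{Re}(s_{ij})>0$ for every non-empty $J\subseteq T$ and $t\in\{1,N-1\}$ (for $J=\{i\}$ this is $1+\operatorname{Re}(s_{ti})>0$). (1) The set $H(\mathbb{C})$ is open and contains the non-empty open connected set given by $-\frac{2}{3}<\operatorname{Re}(s_{1i})<-\frac12$ and $-\frac23<\operatorname{Re}(s_{(N-1)i})<-\frac12$ for $i\in T$ and $-\frac{2}{3N_1}<\operatorname{Re}(s_{ij})<0$ for $i<j$ in $T$, where $N_1=\frac{(N-4)(N-3)}{2}$ (for $N=4$ the last condition is void). For every $\boldsymbol{s}\in H(\mathbb{C})$ the integral $Z^{(N)}(\boldsymbol{s})$ converges absolutely, and $Z^{(N)}$ is holomorphic on $H(\mathbb{C})$.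 It has a meromorphic continuation to $\mathbb{C}^D$ as a rational function in the variables $p^{-s_{ij}}$: there are polynomials $P,Q$ in $D$ variables over $\mathbb{C}$ such that, for all $\boldsymbol{s}\in H(\mathbb{C})$, $Q$ does not vanish at $(p^{-s_{ij}})$ and $Z^{(N)}(\boldsymbol{s})=P(p^{-s_{ij}})/Q(p^{-s_{ij}})$. The real part of every pole of this continuation (a point near which it does not extend holomorphically) lies on one of the finitely many hyperplanes of $\mathbb{R}^D$ obtained by replacing $<$ or $>$ by $=$ in one of the conditions above. (2) If $\boldsymbol{s}\in\mathbb{C}^D$ has all real parts $\operatorname{Re}(s_{1i}),\operatorname{Re}(s_{(N-1)i}),\operatorname{Re}(s_{ij})\ge 0$, then the integral diverges to $+\infty$, in the sense that the integral of the absolute value of the integrand over $\mathbb{Q}_p^{N-3}\smallsetminus\Lambda$ equals $+\infty$. -/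

import Mathlib

namespace KobaNielsen

open MeasureTheory Topology

noncomputable section

/-- The index set `T = {2, …, N - 2}` (used only for `N ≥ 4`). -/
abbrev T (N : ℕ) : Type := ↥(Finset.Icc 2 (N - 2))

/-- The pairs `ij` with `2 ≤ i < j ≤ N - 2`. -/
abbrev Pairs (N : ℕ) : Type := {q : T N × T N // q.1 < q.2}

/-- The indices of the `D = 2(N-3) + (N-3)(N-4)/2` variables: `Sum.inl i` is the index `1i`,
`Sum.inr (Sum.inl i)` is the index `(N-1)i`, and `Sum.inr (Sum.inr ⟨(i, j), _⟩)` is the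
index `ij` with `2 ≤ i < j ≤ N - 2`. -/
abbrev Idx (N : ℕ) : Type := T N ⊕ T N ⊕ Pairs N

/-- The coordinate `s_{1i}`. -/
def c1 {N : ℕ} {R : Type} (s : Idx N → R) (i : T N) : R := s (Sum.inl i)

/-- The coordinate `s_{(N-1)i}`. -/
def cLast {N : ℕ} {R : Type} (s : Idx N → R) (i : T N) : R := s (Sum.inr (Sum.inl i))

/-- The coordinate `s_{ij}`, `2 ≤ i < j ≤ N - 2`. -/
def cPair {N : ℕ} {R : Type} (s : Idx N → R) (q : Pairs N) : R := s (Sum.inr (Sum.inr q))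

/-- The vector of real parts. -/
def rePart {N : ℕ} (s : Idx N → ℂ) : Idx N → ℝ := fun k => (s k).re

/-! ### The integral -/

instance padicMeasurableSpace (p : ℕ) [Fact p.Prime] : MeasurableSpace ℚ_[p] := borel ℚ_[p]

instance padicBorelSpace (p : ℕ) [Fact p.Prime] : BorelSpace ℚ_[p] := ⟨rfl⟩

/-- `ℤ_p`, the closed unit ball of `ℚ_p`, as a compact set with non-empty interior. -/
def unitBall (p : ℕ) [Fact p.Prime] : TopologicalSpace.PositiveCompacts ℚ_[p] where
  carrier := Metric.closedBall 0 1
  isCompact' := isCompact_closedBall 0 1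
  interior_nonempty' :=
    ⟨0, Metric.ball_subset_interior_closedBall (Metric.mem_ball_self one_pos)⟩

/-- The Haar measure of `ℚ_p` with `ℤ_p` of measure one. -/
def haarQp (p : ℕ) [Fact p.Prime] : Measure ℚ_[p] := Measure.addHaarMeasure (unitBall p)

/-- The product measure `∏ dx_i` on `ℚ_p^{N-3}`. -/
def haarN (p : ℕ) [Fact p.Prime] (N : ℕ) : Measure (T N → ℚ_[p]) :=
  Measure.pi fun _ => haarQp p

/-- The set `Λ` on which some factor of the integrand vanishes. -/
def Lam (p : ℕ) [Fact p.Prime] (N : ℕ) : Set (T N → ℚ_[p]) :=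
  {x | (∏ i, x i * (1 - x i)) * ∏ q : Pairs N, (x q.1.1 - x q.1.2) = 0}

/-- The integrand `∏ |x_i|^{s_{1i}} |1 - x_i|^{s_{(N-1)i}} ∏_{i<j} |x_i - x_j|^{s_{ij}}`. -/
def integrand (p : ℕ) [Fact p.Prime] {N : ℕ} (s : Idx N → ℂ) (x : T N → ℚ_[p]) : ℂ :=
  (∏ i, ((‖x i‖ : ℝ) : ℂ) ^ c1 s i * ((‖1 - x i‖ : ℝ) : ℂ) ^ cLast s i) *
    ∏ q : Pairs N, ((‖x q.1.1 - x q.1.2‖ : ℝ) : ℂ) ^ cPair s q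

/-- The `p`-adic open string `N`-point zeta function, as an integral. -/
def zeta (p : ℕ) [Fact p.Prime] (N : ℕ) (s : Idx N → ℂ) : ℂ :=
  ∫ x in (Lam p N)ᶜ, integrand p s x ∂(haarN p N)

/-! ### The affine forms and the region of convergence -/

/-- `|J| + ∑_{i ∈ J} (σ_{1i} + σ_{(N-1)i}) + ∑ σ_{ij}`, the last sum over the pairs `i < j`
with `i ∈ J`, together with those with `i ∈ T \ J` and `j ∈ J`. -/
def formInfty {N : ℕ} (J : Finset (T N)) (σ : Idx N → ℝ) : ℝ :=
  (J.card : ℝ) + ∑ i ∈ J, (c1 σ i + cLast σ i)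
    + (∑ q : Pairs N with q.1.1 ∈ J, cPair σ q)
    + ∑ q : Pairs N with q.1.1 ∉ J ∧ q.1.2 ∈ J, cPair σ q

/-- `|K| - 1 + ∑_{i < j, i, j ∈ K} σ_{ij}`. -/
def formDiag {N : ℕ} (K : Finset (T N)) (σ : Idx N → ℝ) : ℝ :=
  (K.card : ℝ) - 1 + ∑ q : Pairs N with q.1.1 ∈ K ∧ q.1.2 ∈ K, cPair σ q

/-- `|J| + ∑_{i ∈ J} σ_{1i} + ∑_{i < j, i, j ∈ J} σ_{ij}`. -/
def formZero {N : ℕ} (J : Finset (T N)) (σ : Idx N → ℝ) : ℝ :=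
  (J.card : ℝ) + ∑ i ∈ J, c1 σ i + ∑ q : Pairs N with q.1.1 ∈ J ∧ q.1.2 ∈ J, cPair σ q

/-- `|J| + ∑_{i ∈ J} σ_{(N-1)i} + ∑_{i < j, i, j ∈ J} σ_{ij}`. -/
def formOne {N : ℕ} (J : Finset (T N)) (σ : Idx N → ℝ) : ℝ :=
  (J.card : ℝ) + ∑ i ∈ J, cLast σ i + ∑ q : Pairs N with q.1.1 ∈ J ∧ q.1.2 ∈ J, cPair σ q

/-- The region `H(ℂ)`. The conditions `1 + Re s_{ij} > 0`, `1 + Re s_{1i} > 0` and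
`1 + Re s_{(N-1)i} > 0` are the cases `K = {i, j}` and `J = {i}`. -/
def regionH (N : ℕ) : Set (Idx N → ℂ) :=
  {s | (∀ J : Finset (T N), J.Nonempty → formInfty J (rePart s) < 0) ∧
       (∀ K : Finset (T N), 2 ≤ K.card → 0 < formDiag K (rePart s)) ∧
       (∀ J : Finset (T N), J.Nonempty → 0 < formZero J (rePart s)) ∧
       (∀ J : Finset (T N), J.Nonempty → 0 < formOne J (rePart s))}

/-- The finite union of the hyperplanes of `ℝ^D` obtained by replacing the inequality signs in
the conditions that define `regionH N` by equalities. -/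
def polarHyperplanes (N : ℕ) : Set (Idx N → ℝ) :=
  {σ | (∃ J : Finset (T N), J.Nonempty ∧ formInfty J σ = 0) ∨
       (∃ K : Finset (T N), 2 ≤ K.card ∧ formDiag K σ = 0) ∨
       (∃ J : Finset (T N), J.Nonempty ∧ formZero J σ = 0) ∨
       (∃ J : Finset (T N), J.Nonempty ∧ formOne J σ = 0)}

/-- The tube `-2/(3 N₁) < Re s_{ij} < 0`, `-2/3 < Re s_{1i} < -1/2`,
`-2/3 < Re s_{(N-1)i} < -1/2`, where `N₁ = (N-4)(N-3)/2`; for `N = 4` there are no pairs `ij`. -/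
def tube (N : ℕ) : Set (Idx N → ℂ) :=
  {s | (∀ q : Pairs N, -2 / (3 * (((N : ℝ) - 4) * ((N : ℝ) - 3) / 2)) < (cPair s q).re ∧
          (cPair s q).re < 0) ∧
       (∀ i : T N, -2 / 3 < (c1 s i).re ∧ (c1 s i).re < -1 / 2) ∧
       (∀ i : T N, -2 / 3 < (cLast s i).re ∧ (cLast s i).re < -1 / 2)}

/-! ### Rational functions in the `p^{-s_{ij}}` -/

/-- The value at `(p^{-s_{ij}})` of a polynomial in variables indexed like the `s_{ij}`. -/
def evalAt (p : ℕ) {N : ℕ} (P : MvPolynomial (Idx N) ℂ) (s : Idx N → ℂ) : ℂ :=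
  MvPolynomial.eval (fun k => (p : ℂ) ^ (-(s k))) P

/-- The point `s` is a pole (a point of the polar set) of the meromorphic function
`P(p^{-s}) / Q(p^{-s})`: this function, defined off the zeros of `Q(p^{-s})`, does not extend to
a function holomorphic near `s`. -/
def IsPole (p : ℕ) {N : ℕ} (P Q : MvPolynomial (Idx N) ℂ) (s : Idx N → ℂ) : Prop :=
  ¬ ∃ g : (Idx N → ℂ) → ℂ, AnalyticAt ℂ g s ∧
      ∀ᶠ z in 𝓝 s, evalAt p Q z ≠ 0 → g z = evalAt p P z / evalAt p Q z

end

end KobaNielsen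

/-!
The residue classes modulo `p` of the projective line over `ℚ_p` are indexed by the projective line
over `𝔽_p`, and each of them is a copy of `ℤ_p` through a chart `y ↦ a + p y` or `y ↦ 1 / (p y)`.
Points in distinct classes are at chordal distance `1`, so in these charts the integrand, times the
density of the measure, splits into one factor `∏ |y_i - y_j| ^ w_{ij}` for each class. The points
`0`, `1`, `∞` enter as one more point, fixed at `0`, of their classes; its exponents are `s_{1i}`,
`s_{(N-1)i}` and, at `∞`, `-2` minus the total exponent of `x_i`.

The integral of such a cluster `I` over the unit polydisc is decomposed once more by the first
digits of the `y_i`. The families of equal digits reproduce the integral, scaled by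
`p ^ (-(|I| - 1 + ∑ w_{ij}))`, and all others break `I` into smaller clusters. Summing the geometric
series and inducting on `I` gives absolute convergence and a rational expression with factors
`1 - p ^ (-(|I| - 1 + ∑ w_{ij}))` in the denominator. The real parts of the exponents
`|I| - 1 + ∑ w_{ij}` of the clusters that occur are, up to sign, the forms that define `regionH`,
and `1 - p ^ (-z)` vanishes only for `Re z = 0`; this locates the poles.

If all real parts are non-negative, the integrand has absolute value at least `1` wherever
`1 < |x_2| < ⋯ < |x_{N-2}|`, a set of infinite volume.
-/

namespace KobaNielsen

open MeasureTheory Topology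
open scoped NNReal ENNReal Pointwise

noncomputable section

/-! ### Haar measure on `ℚ_p` and `ℤ_p` -/

section Inversion

variable {G₀ : Type*} [CommGroupWithZero G₀] [MeasurableSpace G₀] [MeasurableMul₂ G₀]
  {ν : Measure G₀}

theorem lintegral_comp_mul_left_of_map_eq (hν : ∀ c : G₀, c ≠ 0 → ν.map (c * ·) = ν)
    {g : G₀ → ℝ≥0∞} (hg : Measurable g) {c : G₀} (hc : c ≠ 0) :
    ∫⁻ x, g (c * x) ∂ν = ∫⁻ x, g x ∂ν := by
  rw [← lintegral_map hg (measurable_const_mul c), hν c hc]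

variable [MeasurableInv G₀] [SigmaFinite ν]

/- As for groups: both sides are multiplied by the mass of a test set `S`, and the double integral
of `1_S(x) g(x⁻¹ y)` is evaluated in the two possible orders. -/
theorem isInvInvariant_of_map_mul_left_eq_self (h0 : ν {0} = 0)
    (hν : ∀ c : G₀, c ≠ 0 → ν.map (c * ·) = ν) : ν.IsInvInvariant := by
  rcases eq_or_ne ν 0 with rfl | hne
  · exact ⟨Measure.map_zero _⟩
  have hae : ∀ᵐ x ∂ν, x ≠ 0 := compl_mem_ae_iff.2 h0
  obtain ⟨S, hS, -, hS0, hStop⟩ := Measure.exists_subset_measure_lt_top (μ := ν)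
    MeasurableSet.univ (Measure.measure_univ_pos.2 hne)
  have hf : Measurable (S.indicator (1 : G₀ → ℝ≥0∞)) := measurable_one.indicator hS
  set f := S.indicator (1 : G₀ → ℝ≥0∞)
  have hfν : ∫⁻ x, f x ∂ν = ν S := lintegral_indicator_one hS
  refine ⟨Measure.ext_of_lintegral _ fun g hg => ?_⟩
  rw [Measure.inv_def, lintegral_map hg measurable_inv,
    ← ENNReal.mul_right_inj hS0.ne' hStop.ne, ← hfν]
  symm
  calc (∫⁻ x, f x ∂ν) * ∫⁻ y, g y ∂ν
      = ∫⁻ x, ∫⁻ y, f x * g (x⁻¹ * y) ∂ν ∂ν := by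
        rw [← lintegral_mul_const _ hf]
        refine lintegral_congr_ae (hae.mono fun x hx => ?_)
        dsimp only
        rw [lintegral_const_mul _ (by fun_prop),
          lintegral_comp_mul_left_of_map_eq hν hg (inv_ne_zero hx)]
    _ = ∫⁻ y, ∫⁻ x, f x * g (x⁻¹ * y) ∂ν ∂ν :=
        lintegral_lintegral_swap (by fun_prop)
    _ = ∫⁻ y, ∫⁻ x, f (y * x) * g x⁻¹ ∂ν ∂ν := by
        refine lintegral_congr_ae (hae.mono fun y hy => ?_)
        dsimp only
        rw [← lintegral_comp_mul_left_of_map_eq hν (g := fun x => f x * g (x⁻¹ * y))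
          (by fun_prop) hy]
        refine lintegral_congr fun x => ?_
        rw [mul_inv_rev, inv_mul_cancel_right₀ hy]
    _ = ∫⁻ x, ∫⁻ y, f (x * y) * g x⁻¹ ∂ν ∂ν := by
        rw [lintegral_lintegral_swap (by fun_prop)]
        simp only [mul_comm]
    _ = (∫⁻ x, f x ∂ν) * ∫⁻ x, g x⁻¹ ∂ν := by
        rw [← lintegral_const_mul _ (by fun_prop)]
        refine lintegral_congr_ae (hae.mono fun x hx => ?_)
        dsimp only
        rw [lintegral_mul_const _ (by fun_prop), lintegral_comp_mul_left_of_map_eq hν hf hx]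

end Inversion

section Haar

variable {p : ℕ} [hp : Fact p.Prime]

instance isAddHaarMeasure_haarQp : (haarQp p).IsAddHaarMeasure := by
  unfold haarQp; infer_instance

theorem haarQp_closedBall : haarQp p (Metric.closedBall 0 1) = 1 :=
  Measure.addHaarMeasure_self (K₀ := unitBall p)

instance padicIntMeasurableSpace : MeasurableSpace ℤ_[p] := borel ℤ_[p]

instance padicIntBorelSpace : BorelSpace ℤ_[p] := ⟨rfl⟩

theorem measurableEmbedding_coe : MeasurableEmbedding (PadicInt.Coe.ringHom : ℤ_[p] → ℚ_[p]) :=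
  IsOpenEmbedding.measurableEmbedding (α := ℤ_[p]) PadicInt.isOpenEmbedding_coe

theorem range_coe : Set.range (PadicInt.Coe.ringHom : ℤ_[p] → ℚ_[p]) = Metric.closedBall 0 1 := by
  ext x
  simp only [Set.mem_range, mem_closedBall_zero_iff]
  exact ⟨by rintro ⟨z, rfl⟩; exact z.2, fun h => ⟨⟨x, h⟩, rfl⟩⟩

variable (p) in
/-- The Haar probability measure of `ℤ_p`, obtained by restricting that of `ℚ_p`. -/
def haarZp : Measure ℤ_[p] := (haarQp p).comap PadicInt.Coe.ringHom

theorem haarZp_apply (s : Set ℤ_[p]) : haarZp p s = haarQp p (PadicInt.Coe.ringHom '' s) :=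
  measurableEmbedding_coe.comap_apply _ _

instance isProbabilityMeasure_haarZp : IsProbabilityMeasure (haarZp p) :=
  ⟨by rw [haarZp_apply, Set.image_univ, range_coe, haarQp_closedBall]⟩

instance isAddHaarMeasure_haarZp : (haarZp p).IsAddHaarMeasure :=
  Measure.IsAddHaarMeasure.comap (haarQp p) (mH := inferInstance)
    (f := (PadicInt.Coe.ringHom : ℤ_[p] →+* ℚ_[p]).toAddMonoidHom) PadicInt.isOpenEmbedding_coe

theorem map_coe_haarZp :
    (haarZp p).map PadicInt.Coe.ringHom = (haarQp p).restrict (Metric.closedBall 0 1) := by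
  rw [haarZp, measurableEmbedding_coe.map_comap, range_coe]

/-- The affine chart `y ↦ a + p y` of the residue class `a` modulo `p`. -/
def digitChart (a : ZMod p) (y : ℤ_[p]) : ℤ_[p] := a.val + p * y

@[fun_prop]
theorem measurable_digitChart (a : ZMod p) : Measurable (digitChart a) := by
  unfold digitChart
  exact Continuous.measurable (by fun_prop)

theorem toZMod_digitChart (a : ZMod p) (y : ℤ_[p]) : PadicInt.toZMod (digitChart a y) = a := by
  simp [digitChart]

theorem norm_lt_one_iff_toZMod_eq_zero (z : ℤ_[p]) : ‖z‖ < 1 ↔ PadicInt.toZMod z = 0 := by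
  rw [← PadicInt.mem_nonunits, ← IsLocalRing.mem_maximalIdeal, ← PadicInt.ker_toZMod,
    RingHom.mem_ker]

theorem exists_digitChart_eq (z : ℤ_[p]) : ∃ y, digitChart (PadicInt.toZMod z) y = z := by
  have h : z - (PadicInt.toZMod z).val ∈ RingHom.ker (PadicInt.toZMod : ℤ_[p] →+* ZMod p) := by
    rw [RingHom.mem_ker, map_sub, map_natCast, ZMod.natCast_zmod_val, sub_self]
  rw [PadicInt.ker_toZMod, PadicInt.maximalIdeal_eq_span_p, Ideal.mem_span_singleton'] at h
  obtain ⟨y, hy⟩ := h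
  exact ⟨y, by rw [digitChart, mul_comm, hy, add_sub_cancel]⟩

theorem exists_carry (a : ZMod p) (z : ℤ_[p]) :
    ∃ w, ∀ y, z + digitChart a y = digitChart (PadicInt.toZMod z + a) (w + y) := by
  obtain ⟨w, hw⟩ := exists_digitChart_eq (z + digitChart a 0)
  rw [map_add, toZMod_digitChart] at hw
  refine ⟨w, fun y => ?_⟩
  simp only [digitChart] at hw ⊢
  linear_combination -hw

/- Adding `z` permutes the residue classes and translates each of them, so the right hand side is a
translation invariant probability measure. -/
theorem haarZp_eq_sum_map_digitChart :
    haarZp p = ∑ a : ZMod p, (p : ℝ≥0)⁻¹ • (haarZp p).map (digitChart a) := by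
  set ν := ∑ a : ZMod p, (p : ℝ≥0)⁻¹ • (haarZp p).map (digitChart a) with hν
  have hp0 : (p : ℝ≥0) ≠ 0 := by exact_mod_cast hp.out.ne_zero
  have hprob : IsProbabilityMeasure ν := by
    constructor
    simp only [hν, Measure.coe_finsetSum, Finset.sum_apply, Measure.smul_apply,
      Measure.map_apply (measurable_digitChart _) MeasurableSet.univ, Set.preimage_univ,
      measure_univ, Finset.sum_const, Finset.card_univ, ZMod.card, ENNReal.smul_def, smul_eq_mul,
      mul_one, nsmul_eq_mul]
    exact_mod_cast mul_inv_cancel₀ hp0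
  have hinv : ν.IsAddLeftInvariant := by
    refine ⟨fun z => ?_⟩
    have hclass (a : ZMod p) : ((haarZp p).map (digitChart a)).map (z + ·) =
        (haarZp p).map (digitChart (PadicInt.toZMod z + a)) := by
      obtain ⟨w, hw⟩ := exists_carry a z
      rw [Measure.map_map (by fun_prop) (by fun_prop)]
      conv_rhs => rw [← map_add_left_eq_self (haarZp p) w]
      rw [Measure.map_map (by fun_prop) (by fun_prop)]
      exact congrArg (Measure.map · _) (funext hw)
    rw [hν, ← Measure.mapₗ_apply_of_measurable (by fun_prop), map_sum]
    simp only [Measure.mapₗ_apply_of_measurable (measurable_const_add z), Measure.map_smul, hclass]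
    exact Fintype.sum_equiv (Equiv.addLeft (PadicInt.toZMod z)) _ _ fun _ => rfl
  have h := Measure.isAddLeftInvariant_eq_smul ν (haarZp p)
  have h1 : Measure.addHaarScalarFactor ν (haarZp p) = 1 := by
    have huniv := congrArg (· Set.univ) h
    simp only [Measure.smul_apply, measure_univ, ENNReal.smul_def, smul_eq_mul, mul_one] at huniv
    exact_mod_cast huniv.symm
  rw [h, h1, one_smul]

theorem smul_closedBall_eq_image_digitChart :
    (p : ℚ_[p]) • Metric.closedBall (0 : ℚ_[p]) 1 =
      PadicInt.Coe.ringHom '' Set.range (digitChart (0 : ZMod p)) := by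
  rw [← range_coe, ← Set.image_smul, ← Set.range_comp, ← Set.range_comp]
  congr 1
  ext y
  simp [digitChart]

theorem haarZp_range_digitChart_zero :
    haarZp p (Set.range (digitChart (0 : ZMod p))) = (p : ℝ≥0∞)⁻¹ := by
  have hR : Set.range (digitChart (0 : ZMod p)) = PadicInt.toZMod ⁻¹' {0} := by
    ext z
    refine ⟨by rintro ⟨y, rfl⟩; exact toZMod_digitChart 0 y, fun hz => ?_⟩
    obtain ⟨y, hy⟩ := exists_digitChart_eq z
    exact ⟨y, by rwa [Set.mem_preimage.1 hz] at hy⟩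
  have hpre (a : ZMod p) : digitChart a ⁻¹' (PadicInt.toZMod ⁻¹' {(0 : ZMod p)}) =
      if a = 0 then Set.univ else ∅ := by
    ext y
    by_cases ha : a = 0 <;> simp [toZMod_digitChart, ha]
  have hmeas : MeasurableSet (PadicInt.toZMod ⁻¹' {(0 : ZMod p)} : Set ℤ_[p]) := by
    have : (PadicInt.toZMod ⁻¹' {(0 : ZMod p)} : Set ℤ_[p]) = {z | ‖z‖ < 1} :=
      Set.ext fun z => (norm_lt_one_iff_toZMod_eq_zero z).symm
    rw [this]
    exact measurableSet_lt measurable_norm measurable_const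
  rw [hR, haarZp_eq_sum_map_digitChart, Measure.coe_finsetSum, Finset.sum_apply,
    Finset.sum_eq_single 0]
  · rw [Measure.smul_apply, Measure.map_apply (measurable_digitChart _) hmeas, hpre, if_pos rfl,
      measure_univ, ENNReal.smul_def, smul_eq_mul, mul_one,
      ENNReal.coe_inv (by exact_mod_cast hp.out.ne_zero), ENNReal.coe_natCast]
  · intro a _ ha
    rw [Measure.smul_apply, Measure.map_apply (measurable_digitChart _) hmeas, hpre, if_neg ha,
      measure_empty, smul_zero]
  · exact fun h => absurd (Finset.mem_univ _) h

theorem distribHaarChar_eq_of_smul_closedBall {u : ℚ_[p]ˣ} {r : ℝ≥0}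
    (h : haarQp p (u • Metric.closedBall (0 : ℚ_[p]) 1) = r) : distribHaarChar ℚ_[p] u = r :=
  distribHaarChar_eq_of_measure_smul_eq_mul (μ := haarQp p) (s := Metric.closedBall 0 1)
    (by simp [haarQp_closedBall]) (by simp [haarQp_closedBall]) (by simp [haarQp_closedBall, h])

theorem distribHaarChar_of_nnnorm_eq_one {u : ℚ_[p]ˣ} (hu : ‖(u : ℚ_[p])‖ = 1) :
    distribHaarChar ℚ_[p] u = 1 := by
  apply distribHaarChar_eq_of_smul_closedBall
  rw [Units.smul_def, smul_closedBall' u.ne_zero, smul_zero, hu, mul_one, haarQp_closedBall,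
    ENNReal.coe_one]

theorem distribHaarChar_prime {ϖ : ℚ_[p]ˣ} (hϖ : (ϖ : ℚ_[p]) = p) :
    distribHaarChar ℚ_[p] ϖ = (p : ℝ≥0)⁻¹ := by
  apply distribHaarChar_eq_of_smul_closedBall
  rw [Units.smul_def, hϖ, smul_closedBall_eq_image_digitChart, ← haarZp_apply,
    haarZp_range_digitChart_zero, ENNReal.coe_inv (by exact_mod_cast hp.out.ne_zero),
    ENNReal.coe_natCast]

theorem distribHaarChar_padic (u : ℚ_[p]ˣ) : distribHaarChar ℚ_[p] u = ‖(u : ℚ_[p])‖₊ := by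
  have hp0 : (p : ℚ_[p]) ≠ 0 := by exact_mod_cast hp.out.ne_zero
  set ϖ := Units.mk0 (p : ℚ_[p]) hp0
  set n := (u : ℚ_[p]).valuation
  have hpn : ‖(p : ℚ_[p])‖₊ = (p : ℝ≥0)⁻¹ := by ext; simp
  have hunit : ‖((u * ϖ ^ (-n) : ℚ_[p]ˣ) : ℚ_[p])‖ = 1 := by
    simp only [Units.val_mul, Units.val_zpow_eq_zpow_val, norm_mul, ϖ, Units.val_mk0,
      Padic.norm_p_zpow, Padic.norm_eq_zpow_neg_valuation u.ne_zero]
    rw [← zpow_add₀ (by exact_mod_cast hp.out.ne_zero)]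
    simp [n]
  have hdecomp : u = u * ϖ ^ (-n) * ϖ ^ n := by simp
  rw [hdecomp, map_mul, map_zpow, distribHaarChar_of_nnnorm_eq_one hunit,
    distribHaarChar_prime rfl, Units.val_mul, nnnorm_mul, Units.val_zpow_eq_zpow_val, nnnorm_zpow,
    Units.val_mk0, hpn, one_mul, (NNReal.eq hunit : ‖((u * ϖ ^ (-n) : ℚ_[p]ˣ) : ℚ_[p])‖₊ = 1),
    one_mul]

theorem map_mul_left_haarQp {c : ℚ_[p]} (hc : c ≠ 0) :
    (haarQp p).map (c * ·) = ‖c⁻¹‖ₑ • haarQp p := by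
  ext s hs
  have hpre : (c * ·) ⁻¹' s = (Units.mk0 c hc)⁻¹ • s := by
    rw [← Set.preimage_smul]; rfl
  rw [Measure.map_apply (measurable_const_mul c) hs, hpre, ← distribHaarChar_mul (haarQp p),
    distribHaarChar_padic]
  rfl

theorem lintegral_haarQp_comp_mul_left {c : ℚ_[p]} (hc : c ≠ 0) {g : ℚ_[p] → ℝ≥0∞}
    (hg : Measurable g) : ∫⁻ x, g (c * x) ∂haarQp p = ‖c⁻¹‖ₑ * ∫⁻ x, g x ∂haarQp p := by
  rw [← lintegral_map hg (measurable_const_mul c), map_mul_left_haarQp hc, lintegral_smul_measure,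
    smul_eq_mul]

variable (p) in
/-- The measure `dx / |x|` on `ℚ_p`, a Haar measure of the multiplicative group. -/
def mulHaarQp : Measure ℚ_[p] := (haarQp p).withDensity fun x => ‖x⁻¹‖ₑ

instance sigmaFinite_mulHaarQp : SigmaFinite (mulHaarQp p) := by
  unfold mulHaarQp
  exact SigmaFinite.withDensity_of_ne_top' fun _ => enorm_ne_top

theorem lintegral_mulHaarQp {g : ℚ_[p] → ℝ≥0∞} (hg : Measurable g) :
    ∫⁻ x, g x ∂mulHaarQp p = ∫⁻ x, ‖x⁻¹‖ₑ * g x ∂haarQp p :=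
  lintegral_withDensity_eq_lintegral_mul _ (by fun_prop) hg

theorem map_mul_left_mulHaarQp {c : ℚ_[p]} (hc : c ≠ 0) :
    (mulHaarQp p).map (c * ·) = mulHaarQp p := by
  refine Measure.ext_of_lintegral _ fun g hg => ?_
  rw [lintegral_map hg (by fun_prop), lintegral_mulHaarQp (g := fun x => g (c * x)) (by fun_prop),
    lintegral_mulHaarQp hg]
  calc ∫⁻ x, ‖x⁻¹‖ₑ * g (c * x) ∂haarQp p
      = ∫⁻ x, ‖c‖ₑ * (‖(c * x)⁻¹‖ₑ * g (c * x)) ∂haarQp p := by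
        refine lintegral_congr fun x => ?_
        rw [← mul_assoc, ← enorm_mul, mul_inv, mul_inv_cancel_left₀ hc]
    _ = ∫⁻ x, ‖x⁻¹‖ₑ * g x ∂haarQp p := by
        rw [lintegral_const_mul _ (by fun_prop),
          lintegral_haarQp_comp_mul_left (g := fun x => ‖x⁻¹‖ₑ * g x) hc (by fun_prop),
          ← mul_assoc, ← enorm_mul, mul_inv_cancel₀ hc, enorm_one, one_mul]

instance isInvInvariant_mulHaarQp : (mulHaarQp p).IsInvInvariant :=
  isInvInvariant_of_map_mul_left_eq_self
    (withDensity_absolutelyContinuous _ _ (measure_singleton 0)) fun _ => map_mul_left_mulHaarQp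

theorem lintegral_haarQp_eq_lintegral_mulHaarQp {g : ℚ_[p] → ℝ≥0∞} (hg : Measurable g) :
    ∫⁻ x, g x ∂haarQp p = ∫⁻ x, ‖x‖ₑ * g x ∂mulHaarQp p := by
  rw [lintegral_mulHaarQp (g := fun x => ‖x‖ₑ * g x) (by fun_prop)]
  refine lintegral_congr_ae (((haarQp p).ae_ne 0).mono fun x hx => ?_)
  dsimp only
  rw [← mul_assoc, ← enorm_mul, inv_mul_cancel₀ hx, enorm_one, one_mul]

/-- The charts of the residue classes of `ℙ¹(ℚ_p)`, indexed by `ℙ¹(𝔽_p)`. -/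
def projChart (a : Option (ZMod p)) (y : ℤ_[p]) : ℚ_[p] :=
  match a with
  | none => (p * (y : ℚ_[p]))⁻¹
  | some a => (digitChart a y : ℚ_[p])

/-- The density of the Haar measure of `ℚ_p` in the charts `projChart`. -/
def projDensity (a : Option (ZMod p)) (y : ℤ_[p]) : ℝ≥0 :=
  match a with
  | none => p * ‖y‖₊⁻¹ ^ 2
  | some _ => (p : ℝ≥0)⁻¹

@[fun_prop]
theorem measurable_projChart (a : Option (ZMod p)) : Measurable (projChart a) := by
  have hm := (measurableEmbedding_coe (p := p)).measurable
  cases a with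
  | none => exact (hm.const_mul (p : ℚ_[p])).inv
  | some a => exact hm.comp (measurable_digitChart a)

@[fun_prop]
theorem measurable_projDensity (a : Option (ZMod p)) : Measurable (projDensity a) := by
  cases a <;> unfold projDensity <;> fun_prop

theorem one_lt_norm_inv_prime_mul_iff {x : ℚ_[p]} (hx : x ≠ 0) :
    1 < ‖(p * x)⁻¹‖ ↔ ‖x‖ ≤ 1 := by
  have hp0 : (p : ℚ_[p]) ≠ 0 := by exact_mod_cast hp.out.ne_zero
  rw [norm_inv, one_lt_inv₀ (norm_pos_iff.2 (mul_ne_zero hp0 hx)), norm_mul, Padic.norm_p,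
    inv_mul_lt_one₀ (by exact_mod_cast hp.out.pos)]
  simpa using (Padic.norm_le_pow_iff_norm_lt_pow_add_one x 0).symm

/- `x ↦ 1 / (p x)` preserves `dx / |x|` and interchanges `|x| ≤ 1` and `|x| > 1`. -/
theorem setLIntegral_compl_closedBall_haarQp {g : ℚ_[p] → ℝ≥0∞} (hg : Measurable g) :
    ∫⁻ x in (Metric.closedBall 0 1)ᶜ, g x ∂haarQp p =
      ∫⁻ x in Metric.closedBall 0 1, p * ‖x⁻¹‖ₑ ^ 2 * g (p * x : ℚ_[p])⁻¹ ∂haarQp p := by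
  have hp0 : (p : ℚ_[p]) ≠ 0 := by exact_mod_cast hp.out.ne_zero
  have hpn : ‖(p : ℚ_[p])⁻¹‖ₑ = p := by
    rw [enorm_eq_nnnorm, ← ENNReal.coe_natCast, ENNReal.coe_inj]
    ext
    simp
  have hB : MeasurableSet (Metric.closedBall (0 : ℚ_[p]) 1) := measurableSet_closedBall
  set h : ℚ_[p] → ℝ≥0∞ := fun x => ‖x‖ₑ * (Metric.closedBall (0 : ℚ_[p]) 1)ᶜ.indicator g x
    with hh
  have hhm : Measurable h := measurable_enorm.mul (hg.indicator hB.compl)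
  have hchart (x : ℚ_[p]) (hx : x ≠ 0) : ‖x⁻¹‖ₑ * h (p * x)⁻¹ =
      (Metric.closedBall 0 1).indicator (fun x => p * ‖x⁻¹‖ₑ ^ 2 * g (p * x : ℚ_[p])⁻¹) x := by
    classical
    simp only [hh, Set.indicator_apply, Set.mem_compl_iff, mem_closedBall_zero_iff, not_le,
      one_lt_norm_inv_prime_mul_iff hx]
    split_ifs
    · rw [mul_inv, enorm_mul, hpn]
      ring
    · simp only [mul_zero]
  calc ∫⁻ x in (Metric.closedBall 0 1)ᶜ, g x ∂haarQp p
      = ∫⁻ x, h x ∂mulHaarQp p := by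
        rw [← lintegral_indicator hB.compl, lintegral_haarQp_eq_lintegral_mulHaarQp
          (hg.indicator hB.compl)]
    _ = ∫⁻ x, h (p * x : ℚ_[p])⁻¹ ∂mulHaarQp p := by
        rw [← lintegral_inv_eq_self, lintegral_comp_mul_left_of_map_eq
          (fun _ => map_mul_left_mulHaarQp) (g := fun x => h x⁻¹) (by fun_prop) hp0]
    _ = ∫⁻ x in Metric.closedBall 0 1, p * ‖x⁻¹‖ₑ ^ 2 * g (p * x : ℚ_[p])⁻¹ ∂haarQp p := by
        rw [lintegral_mulHaarQp (g := fun x : ℚ_[p] => h (p * x)⁻¹) (by fun_prop),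
          ← lintegral_indicator hB]
        exact lintegral_congr_ae (((haarQp p).ae_ne 0).mono hchart)

theorem restrict_compl_closedBall_haarQp :
    (haarQp p).restrict (Metric.closedBall 0 1)ᶜ =
      ((haarZp p).withDensity fun y => projDensity none y).map (projChart none) := by
  refine Measure.ext_of_lintegral _ fun g hg => ?_
  rw [setLIntegral_compl_closedBall_haarQp hg, ← map_coe_haarZp,
    measurableEmbedding_coe.lintegral_map, lintegral_map hg (measurable_projChart none),
    lintegral_withDensity_eq_lintegral_mul _ (by fun_prop)
      (g := fun y => g (projChart none y)) (by fun_prop)]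
  refine lintegral_congr fun y => ?_
  rw [enorm_eq_nnnorm, nnnorm_inv, Pi.mul_apply, projDensity, ENNReal.coe_mul, ENNReal.coe_pow,
    ENNReal.coe_natCast]
  rfl

theorem haarQp_eq_sum_map_projChart : haarQp p = ∑ a : Option (ZMod p),
    ((haarZp p).withDensity fun y => projDensity a y).map (projChart a) := by
  have hB : MeasurableSet (Metric.closedBall (0 : ℚ_[p]) 1) := measurableSet_closedBall
  have hm := (measurableEmbedding_coe (p := p)).measurable
  rw [Fintype.sum_option, ← restrict_compl_closedBall_haarQp]
  conv_lhs => rw [← Measure.restrict_compl_add_restrict (μ := haarQp p) hB, ← map_coe_haarZp,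
    haarZp_eq_sum_map_digitChart, ← Measure.mapₗ_apply_of_measurable hm, map_sum]
  congr 1
  refine Finset.sum_congr rfl fun a _ => ?_
  simp only [Measure.mapₗ_apply_of_measurable hm, projDensity, withDensity_const]
  rw [Measure.map_smul, Measure.map_smul, Measure.map_map hm (measurable_digitChart a)]
  rfl

theorem haarZp_eq_sum_map_withDensity : haarZp p = ∑ a : ZMod p,
    ((haarZp p).withDensity fun _ => ((p : ℝ≥0)⁻¹ : ℝ≥0)).map (digitChart a) := by
  simp only [withDensity_const, Measure.map_smul]
  exact haarZp_eq_sum_map_digitChart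

end Haar

/-! ### Product measures -/

section PiMeasure

variable {ι : Type*} [Fintype ι]

theorem lintegral_pi_prod {Y : ι → Type*} [∀ i, MeasurableSpace (Y i)] {μ : ∀ i, Measure (Y i)}
    [∀ i, IsProbabilityMeasure (μ i)] {g : ∀ i, Y i → ℝ≥0∞} (hg : ∀ i, Measurable (g i)) :
    ∫⁻ y, ∏ i, g i (y i) ∂(Measure.pi μ) = ∏ i, ∫⁻ y, g i y ∂(μ i) := by
  have hindep := ProbabilityTheory.iIndepFun_pi (μ := μ) (X := g) fun i => (hg i).aemeasurable
  rw [ProbabilityTheory.lintegral_prod_eq_prod_lintegral_of_indepFun Finset.univ _ hindep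
    fun i => (hg i).comp (measurable_pi_apply i)]
  exact Finset.prod_congr rfl fun i _ => (measurePreserving_eval μ i).lintegral_comp (hg i)

section Charts

variable {A X Y : Type*} [MeasurableSpace X] [MeasurableSpace Y] {φ : A → Y → X} {ρ : A → Y → ℝ≥0}
  {E : Type*} [NormedAddCommGroup E] [NormedSpace ℝ E] {G : (ι → X) → E}

omit [Fintype ι] in
theorem measurable_pi_chart (hφ : ∀ a, Measurable (φ a)) (f : ι → A) :
    Measurable fun (y : ι → Y) i => φ (f i) (y i) := by
  fun_prop

theorem measurable_pi_density (hρ : ∀ a, Measurable (ρ a)) (f : ι → A) :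
    Measurable fun y : ι → Y => ∏ i, ρ (f i) (y i) := by
  fun_prop

variable {μ : Measure Y}

theorem integrable_map_withDensity_pi_chart_iff (hφ : ∀ a, Measurable (φ a))
    (hρ : ∀ a, Measurable (ρ a)) (hG : StronglyMeasurable G) (f : ι → A) :
    Integrable G (((Measure.pi fun _ : ι => μ).withDensity
        fun y => ((∏ i, ρ (f i) (y i) : ℝ≥0) : ℝ≥0∞)).map fun y i => φ (f i) (y i)) ↔
      Integrable (fun y => (∏ i, ρ (f i) (y i)) • G (fun i => φ (f i) (y i)))
        (Measure.pi fun _ : ι => μ) := by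
  rw [integrable_map_measure hG.aestronglyMeasurable (measurable_pi_chart hφ f).aemeasurable,
    integrable_withDensity_iff_integrable_smul (measurable_pi_density hρ f)]
  rfl

variable [IsProbabilityMeasure μ]

theorem map_withDensity_pi_chart_apply (hφ : ∀ a, Measurable (φ a)) (hρ : ∀ a, Measurable (ρ a))
    (f : ι → A) {s : ι → Set X} (hs : ∀ i, MeasurableSet (s i)) :
    ((Measure.pi fun _ : ι => μ).withDensity
        fun y => ((∏ i, ρ (f i) (y i) : ℝ≥0) : ℝ≥0∞)).map (fun y i => φ (f i) (y i))
        (Set.univ.pi s) =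
      ∏ i, ((μ.withDensity fun y => ρ (f i) y).map (φ (f i))) (s i) := by
  have hbox := measurable_pi_chart hφ f (MeasurableSet.univ_pi hs)
  rw [Measure.map_apply (measurable_pi_chart hφ f) (MeasurableSet.univ_pi hs),
    withDensity_apply _ hbox, ← lintegral_indicator hbox]
  simp_rw [Measure.map_apply (hφ _) (hs _), withDensity_apply _ (hφ _ (hs _)),
    ← lintegral_indicator (hφ _ (hs _))]
  rw [← lintegral_pi_prod fun i => (hρ (f i)).coe_nnreal_ennreal.indicator (hφ (f i) (hs i))]
  classical
  refine lintegral_congr fun y => ?_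
  simp only [Set.indicator_apply, Finset.prod_ite_zero, Set.mem_preimage, Set.mem_univ_pi,
    Finset.mem_univ, true_imp_iff, ENNReal.ofNNReal_finsetProd]

variable [DecidableEq ι] [Fintype A] {ν : Measure X} [SigmaFinite ν]

theorem pi_eq_sum_chart (hφ : ∀ a, Measurable (φ a)) (hρ : ∀ a, Measurable (ρ a))
    (hν : ν = ∑ a, (μ.withDensity fun y => ρ a y).map (φ a)) :
    Measure.pi (fun _ : ι => ν) =
      ∑ f : ι → A, ((Measure.pi fun _ : ι => μ).withDensity
        fun y => ((∏ i, ρ (f i) (y i) : ℝ≥0) : ℝ≥0∞)).map fun y i => φ (f i) (y i) := by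
  refine Measure.pi_eq fun s hs => ?_
  rw [Measure.finsetSum_apply,
    Finset.sum_congr rfl fun f _ => map_withDensity_pi_chart_apply hφ hρ f hs,
    ← Fintype.piFinset_univ, ← Finset.prod_univ_sum (fun _ => Finset.univ)
      fun i a => ((μ.withDensity fun y => ρ a y).map (φ a)) (s i)]
  refine Finset.prod_congr rfl fun i _ => ?_
  conv_lhs => rw [← Measure.finsetSum_apply, ← hν]

theorem lintegral_pi_eq_sum_chart (hφ : ∀ a, Measurable (φ a)) (hρ : ∀ a, Measurable (ρ a))
    (hν : ν = ∑ a, (μ.withDensity fun y => ρ a y).map (φ a))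
    {G : (ι → X) → ℝ≥0∞} (hG : Measurable G) :
    ∫⁻ x, G x ∂(Measure.pi fun _ : ι => ν) =
      ∑ f : ι → A, ∫⁻ y, ((∏ i, ρ (f i) (y i) : ℝ≥0) : ℝ≥0∞) * G (fun i => φ (f i) (y i))
        ∂(Measure.pi fun _ : ι => μ) := by
  rw [pi_eq_sum_chart hφ hρ hν, lintegral_finsetSum_measure]
  refine Finset.sum_congr rfl fun f _ => ?_
  rw [lintegral_map hG (measurable_pi_chart hφ f)]
  exact lintegral_withDensity_eq_lintegral_mul _
    (measurable_pi_density hρ f).coe_nnreal_ennreal (hG.comp (measurable_pi_chart hφ f))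

omit [DecidableEq ι] in
theorem integrable_pi_iff_forall_chart (hφ : ∀ a, Measurable (φ a)) (hρ : ∀ a, Measurable (ρ a))
    (hν : ν = ∑ a, (μ.withDensity fun y => ρ a y).map (φ a)) (hG : StronglyMeasurable G) :
    Integrable G (Measure.pi fun _ : ι => ν) ↔ ∀ f : ι → A,
      Integrable (fun y => (∏ i, ρ (f i) (y i)) • G (fun i => φ (f i) (y i)))
        (Measure.pi fun _ : ι => μ) := by
  classical
  simp only [pi_eq_sum_chart hφ hρ hν, integrable_finsetSum_measure, Finset.mem_univ,
    true_imp_iff, integrable_map_withDensity_pi_chart_iff hφ hρ hG]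

theorem integral_pi_eq_sum_chart (hφ : ∀ a, Measurable (φ a)) (hρ : ∀ a, Measurable (ρ a))
    (hν : ν = ∑ a, (μ.withDensity fun y => ρ a y).map (φ a)) (hG : StronglyMeasurable G)
    (hint : ∀ f : ι → A,
      Integrable (fun y => (∏ i, ρ (f i) (y i)) • G (fun i => φ (f i) (y i)))
        (Measure.pi fun _ : ι => μ)) :
    ∫ x, G x ∂(Measure.pi fun _ : ι => ν) =
      ∑ f : ι → A, ∫ y, (∏ i, ρ (f i) (y i)) • G (fun i => φ (f i) (y i))
        ∂(Measure.pi fun _ : ι => μ) := by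
  rw [pi_eq_sum_chart hφ hρ hν, integral_finsetSum_measure fun f _ =>
    (integrable_map_withDensity_pi_chart_iff hφ hρ hG f).2 (hint f)]
  refine Finset.sum_congr rfl fun f _ => ?_
  rw [integral_map (measurable_pi_chart hφ f).aemeasurable hG.aestronglyMeasurable,
    integral_withDensity_eq_integral_smul (measurable_pi_density hρ f)]

end Charts

section Independence

variable {Y : ι → Type*}

omit [Fintype ι] in
theorem comp_updateFinset_of_dependsOn [DecidableEq ι] {β : Type*} {V : Finset ι}
    {f : (∀ i, Y i) → β}
    (hf : DependsOn f V) (y₀ : ∀ i, Y i) :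
    (fun z : ∀ i : V, Y i => f (Function.updateFinset y₀ V z)) ∘ (fun y (i : V) => y i) = f :=
  funext fun y => hf fun i hi => by simp [Function.updateFinset, Finset.mem_coe.1 hi]

variable [∀ i, MeasurableSpace (Y i)] {μ : ∀ i, Measure (Y i)} [∀ i, IsProbabilityMeasure (μ i)]

theorem indepFun_pi_of_dependsOn {β γ : Type*} [MeasurableSpace β] [MeasurableSpace γ]
    {S U : Finset ι} (hSU : Disjoint S U) {f : (∀ i, Y i) → β} {g : (∀ i, Y i) → γ}
    (hf : Measurable f) (hg : Measurable g) (hfS : DependsOn f S) (hgU : DependsOn g U) :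
    ProbabilityTheory.IndepFun f g (Measure.pi μ) := by
  classical
  obtain ⟨y₀⟩ := nonempty_of_isProbabilityMeasure (Measure.pi μ)
  have hcoord := ProbabilityTheory.iIndepFun_pi (μ := μ) (X := fun _ y => y)
    fun i => aemeasurable_id
  rw [← comp_updateFinset_of_dependsOn hfS y₀, ← comp_updateFinset_of_dependsOn hgU y₀]
  exact (hcoord.indepFun_finset S U hSU fun i => measurable_pi_apply i).comp
    (hf.comp measurable_updateFinset) (hg.comp measurable_updateFinset)

variable {κ : Type*} {S : κ → Finset ι}

theorem iIndepFun_pi_of_dependsOn {β : κ → Type*} [∀ a, MeasurableSpace (β a)]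
    (hS : Pairwise fun a b => Disjoint (S a) (S b)) {g : ∀ a, (∀ i, Y i) → β a}
    (hm : ∀ a, Measurable (g a)) (hg : ∀ a, DependsOn (g a) (S a)) :
    ProbabilityTheory.iIndepFun g (Measure.pi μ) := by
  classical
  refine ProbabilityTheory.iIndepFun_iff_measure_inter_preimage_eq_mul.2 fun t B hB => ?_
  induction t using Finset.induction_on with
  | empty => simp
  | insert a t ha ih =>
    have hB' : ∀ b ∈ t, MeasurableSet (B b) := fun b hb => hB b (Finset.mem_insert_of_mem hb)
    have hdisj : Disjoint (S a) (t.biUnion S) :=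
      (Finset.disjoint_biUnion_right _ _ _).2 fun b hb => hS fun h => ha (h ▸ hb)
    have htail : DependsOn (fun y (b : t) => g b y) (t.biUnion S) := fun y y' h =>
      funext fun b => hg b fun i hi => h i (Finset.mem_biUnion.2 ⟨b, b.2, hi⟩)
    have hindep := indepFun_pi_of_dependsOn (μ := μ) hdisj (hm a)
      (measurable_pi_lambda _ fun b : t => hm b) (hg a) htail
    have hinter : ⋂ b ∈ t, g b ⁻¹' B b =
        (fun y (b : t) => g b y) ⁻¹' Set.univ.pi fun b : t => B b := by
      ext y
      simp
    rw [Finset.set_biInter_insert, Finset.prod_insert ha, ← ih hB', hinter]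
    exact hindep.measure_inter_preimage_eq_mul _ _ (hB a (Finset.mem_insert_self _ _))
      (MeasurableSet.univ_pi fun b => hB' b b.2)

variable [Fintype κ] {𝕜 : Type*} [RCLike 𝕜] {g : κ → (∀ i, Y i) → 𝕜}

theorem integral_pi_prod_of_dependsOn (hS : Pairwise fun a b => Disjoint (S a) (S b))
    (hm : ∀ a, Measurable (g a)) (hg : ∀ a, DependsOn (g a) (S a)) :
    ∫ y, ∏ a, g a y ∂(Measure.pi μ) = ∏ a, ∫ y, g a y ∂(Measure.pi μ) :=
  (iIndepFun_pi_of_dependsOn hS hm hg).integral_fun_prod_eq_prod_integral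
    fun a => (hm a).aestronglyMeasurable

theorem integrable_pi_prod_of_dependsOn (hS : Pairwise fun a b => Disjoint (S a) (S b))
    (hm : ∀ a, Measurable (g a)) (hg : ∀ a, DependsOn (g a) (S a))
    (hint : ∀ a, Integrable (g a) (Measure.pi μ)) :
    Integrable (fun y => ∏ a, g a y) (Measure.pi μ) := by
  refine ⟨(Finset.measurable_fun_prod _ fun a _ => hm a).aestronglyMeasurable, ?_⟩
  have hindep := (iIndepFun_pi_of_dependsOn (μ := μ) hS hm hg).comp (fun _ z => (‖z‖₊ : ℝ≥0∞))
    fun _ => measurable_nnnorm.coe_nnreal_ennreal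
  rw [hasFiniteIntegral_iff_enorm]
  simp only [enorm_eq_nnnorm, nnnorm_prod, ENNReal.ofNNReal_finsetProd]
  rw [ProbabilityTheory.lintegral_prod_eq_prod_lintegral_of_indepFun Finset.univ
    (fun a y => (‖g a y‖₊ : ℝ≥0∞)) hindep fun a => (hm a).enorm]
  exact ENNReal.prod_lt_top fun a _ => (hint a).2

end Independence

end PiMeasure

section Cpw

/-- The power `t ^ s`, with value `0` at `t = 0` for every exponent: unlike `Complex.cpow`, which
gives `0 ^ 0 = 1`, it is multiplicative in the exponent without exception. -/
def cpw (t : ℝ) (s : ℂ) : ℂ := if t = 0 then 0 else (t : ℂ) ^ s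

theorem cpw_zero (s : ℂ) : cpw 0 s = 0 := if_pos rfl

theorem cpw_one (s : ℂ) : cpw 1 s = 1 := by simp [cpw]

theorem cpw_of_ne_zero {t : ℝ} (ht : t ≠ 0) (s : ℂ) : cpw t s = (t : ℂ) ^ s := if_neg ht

theorem cpw_mul {t u : ℝ} (ht : 0 ≤ t) (hu : 0 ≤ u) (s : ℂ) :
    cpw (t * u) s = cpw t s * cpw u s := by
  rcases ht.eq_or_lt with rfl | ht
  · simp [cpw_zero]
  rcases hu.eq_or_lt with rfl | hu
  · simp [cpw_zero]
  rw [cpw_of_ne_zero (mul_pos ht hu).ne', cpw_of_ne_zero ht.ne', cpw_of_ne_zero hu.ne',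
    Complex.ofReal_mul, Complex.mul_cpow_ofReal_nonneg ht.le hu.le]

theorem cpw_add (t : ℝ) (s r : ℂ) : cpw t (s + r) = cpw t s * cpw t r := by
  by_cases ht : t = 0
  · simp [cpw, ht]
  · rw [cpw_of_ne_zero ht, cpw_of_ne_zero ht, cpw_of_ne_zero ht,
      Complex.cpow_add _ _ (by exact_mod_cast ht)]

theorem cpw_sum {κ : Type*} {t : ℝ} (ht : t ≠ 0) (A : Finset κ) (s : κ → ℂ) :
    cpw t (∑ a ∈ A, s a) = ∏ a ∈ A, cpw t (s a) := by
  classical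
  induction A using Finset.induction_on with
  | empty => simp [cpw, ht]
  | insert a A ha ih => rw [Finset.sum_insert ha, Finset.prod_insert ha, cpw_add, ih]

theorem cpw_inv {t : ℝ} (ht : 0 ≤ t) (s : ℂ) : cpw t⁻¹ s = cpw t (-s) := by
  rcases ht.eq_or_lt with rfl | ht
  · simp [cpw_zero]
  have harg : (t : ℂ).arg ≠ Real.pi := by
    rw [Complex.arg_ofReal_of_nonneg ht.le]
    exact Real.pi_pos.ne
  rw [cpw_of_ne_zero (by positivity), cpw_of_ne_zero ht.ne', Complex.ofReal_inv,
    Complex.inv_cpow _ _ harg, Complex.cpow_neg]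

theorem cpw_inv_natCast {p : ℕ} (hp : p ≠ 0) (s : ℂ) : cpw (p : ℝ)⁻¹ s = (p : ℂ) ^ (-s) := by
  rw [cpw_inv p.cast_nonneg, cpw_of_ne_zero (Nat.cast_ne_zero.2 hp), Complex.ofReal_natCast]

@[fun_prop]
theorem measurable_cpw (s : ℂ) : Measurable fun t : ℝ => cpw t s := by
  unfold cpw
  refine Measurable.ite (measurableSet_singleton 0) measurable_const ?_
  fun_prop

end Cpw

/-! ### Cluster integrals over `ℤ_p` -/

section Cluster

variable {p : ℕ} {τ : Type*}

/-- Extend a family by the value `0` at the additional index `⊥`. It lets the factors `|x_i|` be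
treated as differences `|x_i - x_⊥|`. -/
def extendZero {R : Type*} [Zero R] (y : τ → R) : WithBot τ → R
  | ⊥ => 0
  | (i : τ) => y i

section Fibres

/-- The indices in `I` at which the digit family `f`, extended by the digit `0` at `⊥`, takes the
value `a`. -/
def fibre (f : τ → ZMod p) (I : Finset (WithBot τ)) (a : ZMod p) : Finset (WithBot τ) :=
  I.filter fun k => extendZero f k = a

/-- The digit family `f`, extended by the digit `0` at `⊥`, is constant on `I`. -/
def ConstOn (f : τ → ZMod p) (I : Finset (WithBot τ)) : Prop :=
  ∀ k ∈ I, ∀ l ∈ I, extendZero f k = extendZero f l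

instance decidableConstOn (f : τ → ZMod p) (I : Finset (WithBot τ)) : Decidable (ConstOn f I) := by
  unfold ConstOn; infer_instance

theorem fibre_eq_self_of_constOn {f : τ → ZMod p} {I : Finset (WithBot τ)} (h : ConstOn f I)
    {k : WithBot τ} (hk : k ∈ I) : fibre f I (extendZero f k) = I :=
  Finset.filter_true_of_mem fun l hl => h l hl k hk

theorem fibre_eq_empty_of_constOn {f : τ → ZMod p} {I : Finset (WithBot τ)} (h : ConstOn f I)
    {k : WithBot τ} (hk : k ∈ I) {a : ZMod p} (ha : a ≠ extendZero f k) : fibre f I a = ∅ :=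
  Finset.filter_false_of_mem fun l hl hla => ha (hla.symm.trans (h l hl k hk))

theorem fibre_ssubset_of_not_constOn {f : τ → ZMod p} {I : Finset (WithBot τ)} (h : ¬ConstOn f I)
    (a : ZMod p) : fibre f I a ⊂ I := by
  refine (Finset.filter_subset _ _).ssubset_of_ne fun he => h fun k hk l hl => ?_
  rw [Finset.filter_eq_self.1 he k hk, Finset.filter_eq_self.1 he l hl]

theorem prod_fibre_of_constOn [NeZero p] {M : Type*} [CommMonoid M] {f : τ → ZMod p}
    {I : Finset (WithBot τ)} (h : ConstOn f I) (hI : I.Nonempty) {g : Finset (WithBot τ) → M}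
    (hg : g ∅ = 1) : ∏ a, g (fibre f I a) = g I := by
  obtain ⟨k, hk⟩ := hI
  rw [Fintype.prod_eq_single (extendZero f k) fun a ha => ?_, fibre_eq_self_of_constOn h hk]
  rw [fibre_eq_empty_of_constOn h hk ha, hg]

end Fibres

section Pairs

variable [LinearOrder τ]

/-- The pairs `i < j` of elements of `I`. -/
def pairsIn (I : Finset (WithBot τ)) : Finset (WithBot τ × WithBot τ) :=
  (I ×ˢ I).filter fun q => q.1 < q.2

theorem mem_pairsIn {I : Finset (WithBot τ)} {q : WithBot τ × WithBot τ} :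
    q ∈ pairsIn I ↔ (q.1 ∈ I ∧ q.2 ∈ I) ∧ q.1 < q.2 := by
  simp [pairsIn]

theorem pairsIn_eq_empty {I : Finset (WithBot τ)} (hI : I.card ≤ 1) : pairsIn I = ∅ := by
  refine Finset.eq_empty_of_forall_notMem fun q hq => ?_
  rw [mem_pairsIn] at hq
  exact hq.2.ne (Finset.card_le_one.1 hI _ hq.1.1 _ hq.1.2)

theorem pairsIn_fibre (f : τ → ZMod p) (I : Finset (WithBot τ)) (a : ZMod p) :
    pairsIn (fibre f I a) =
      (pairsIn I).filter fun q => extendZero f q.1 = a ∧ extendZero f q.2 = a := by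
  ext q
  simp only [Finset.mem_filter, mem_pairsIn, fibre]
  tauto

theorem prod_pairsIn_fibre [NeZero p] {M : Type*} [CommMonoid M] (f : τ → ZMod p)
    (I : Finset (WithBot τ)) (g : WithBot τ × WithBot τ → M) :
    ∏ a, ∏ q ∈ pairsIn (fibre f I a), g q =
      ∏ q ∈ pairsIn I, if extendZero f q.1 = extendZero f q.2 then g q else 1 := by
  simp only [pairsIn_fibre, Finset.prod_filter]
  rw [Finset.prod_comm]
  refine Finset.prod_congr rfl fun q _ => ?_
  simp only [ite_and, Finset.prod_ite_eq, Finset.mem_univ, if_true]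
  exact if_congr eq_comm rfl rfl

end Pairs

section Counting

/-- The elements of `I` other than `⊥`. -/
def ordinary (I : Finset (WithBot τ)) : Finset τ :=
  I.preimage WithBot.some WithBot.coe_injective.injOn

theorem mem_ordinary {I : Finset (WithBot τ)} {i : τ} : i ∈ ordinary I ↔ (i : WithBot τ) ∈ I :=
  Finset.mem_preimage

theorem card_eq_card_ordinary_add [DecidableEq τ] (I : Finset (WithBot τ)) :
    I.card = (ordinary I).card + if ⊥ ∈ I then 1 else 0 := by
  have herase : I.erase ⊥ = (ordinary I).map ⟨WithBot.some, WithBot.coe_injective⟩ := by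
    ext k
    cases k <;> simp [mem_ordinary]
  rw [← Finset.card_map (s := ordinary I) ⟨WithBot.some, WithBot.coe_injective⟩, ← herase]
  split_ifs with hb
  · rw [Finset.card_erase_add_one hb]
  · rw [Finset.erase_eq_of_notMem hb, add_zero]

theorem disjoint_ordinary_fibre (f : τ → ZMod p) (I : Finset (WithBot τ)) :
    Pairwise fun a b => Disjoint (ordinary (fibre f I a)) (ordinary (fibre f I b)) := by
  intro a b hab
  rw [Finset.disjoint_left]
  intro i hi hj
  simp only [mem_ordinary, fibre, Finset.mem_filter] at hi hj
  exact hab (hi.2.symm.trans hj.2)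

variable [Fintype τ] [NeZero p] [DecidableEq τ]

theorem card_filter_extendZero_eq_mul (I : Finset (WithBot τ)) (a : ZMod p) :
    (Finset.univ.filter fun f : τ → ZMod p => ∀ k ∈ I, extendZero f k = a).card *
        p ^ (ordinary I).card =
      if ⊥ ∈ I → a = 0 then p ^ Fintype.card τ else 0 := by
  split_ifs with hbot
  · have hset : (Finset.univ.filter fun f : τ → ZMod p => ∀ k ∈ I, extendZero f k = a) =
        Fintype.piFinset fun i : τ => if (i : WithBot τ) ∈ I then {a} else Finset.univ := by
      ext f
      simp only [Finset.mem_filter, Finset.mem_univ, true_and, Fintype.mem_piFinset,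
        WithBot.forall, extendZero]
      refine ⟨fun h i => ?_, fun h => ⟨fun hb => (hbot hb).symm, fun i hi => ?_⟩⟩
      · split_ifs with hi
        · exact Finset.mem_singleton.2 (h.2 i hi)
        · exact Finset.mem_univ _
      · simpa [hi] using h i
    have hord : ordinary I = Finset.univ.filter fun i : τ => (i : WithBot τ) ∈ I := by
      ext i
      simp [mem_ordinary]
    rw [hset, Fintype.card_piFinset, hord, ← Finset.prod_const, Finset.prod_filter,
      ← Finset.prod_mul_distrib, ← Finset.card_univ, ← Finset.prod_const]
    refine Finset.prod_congr rfl fun i _ => ?_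
    split_ifs <;> simp [ZMod.card]
  · obtain ⟨hb, ha⟩ := Classical.not_imp.1 hbot
    rw [Finset.filter_false_of_mem fun f _ h => ha (h ⊥ hb).symm, Finset.card_empty, zero_mul]

theorem card_constOn_eq_sum {I : Finset (WithBot τ)} (hI : I.Nonempty) :
    (Finset.univ.filter fun f : τ → ZMod p => ConstOn f I).card =
      ∑ a, (Finset.univ.filter fun f : τ → ZMod p => ∀ k ∈ I, extendZero f k = a).card := by
  obtain ⟨k, hk⟩ := hI
  rw [Finset.card_eq_sum_card_fiberwise (f := fun f => extendZero f k)
    fun _ _ => Finset.mem_coe.2 (Finset.mem_univ _)]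
  refine Finset.sum_congr rfl fun a _ => congrArg Finset.card ?_
  ext f
  simp only [Finset.mem_filter, Finset.mem_univ, true_and]
  exact ⟨fun h l hl => (h.1 l hl k hk).trans h.2,
    fun h => ⟨fun l hl m hm => (h l hl).trans (h m hm).symm, h k hk⟩⟩

theorem card_constOn_mul_pow {I : Finset (WithBot τ)} (hI : I.Nonempty) :
    (Finset.univ.filter fun f : τ → ZMod p => ConstOn f I).card * p ^ (I.card - 1) =
      p ^ Fintype.card τ := by
  have hsum : (Finset.univ.filter fun f : τ → ZMod p => ConstOn f I).card *
      p ^ (ordinary I).card = ∑ a : ZMod p, if ⊥ ∈ I → a = 0 then p ^ Fintype.card τ else 0 := by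
    rw [card_constOn_eq_sum hI, Finset.sum_mul]
    exact Finset.sum_congr rfl fun a _ => card_filter_extendZero_eq_mul I a
  have hcard := card_eq_card_ordinary_add I
  have hpos := hI.card_pos
  by_cases hb : ⊥ ∈ I
  · simp only [hb, true_imp_iff, Finset.sum_ite_eq', Finset.mem_univ, if_true] at hsum hcard
    rw [hcard, Nat.add_sub_cancel, hsum]
  · simp only [hb, false_imp_iff, if_true, Finset.sum_const, Finset.card_univ, ZMod.card,
      smul_eq_mul, if_false, add_zero] at hsum hcard
    refine Nat.eq_of_mul_eq_mul_left (NeZero.pos p) ?_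
    rw [mul_left_comm, ← pow_succ', Nat.sub_add_cancel hpos, hcard, hsum]

end Counting

section Integrand

variable [LinearOrder τ] [hp : Fact p.Prime]

/-- The integrand of the cluster integral: the product of `|y_i - y_j| ^ w_{ij}` over the pairs in
`I`, where `y_⊥ = 0`. -/
def cluster (w : WithBot τ × WithBot τ → ℂ) (I : Finset (WithBot τ)) (y : τ → ℤ_[p]) : ℂ :=
  ∏ q ∈ pairsIn I, cpw ‖extendZero y q.1 - extendZero y q.2‖ (w q)

/-- The sum of the weights of the pairs in `I`. -/
def weightSum (w : WithBot τ × WithBot τ → ℂ) (I : Finset (WithBot τ)) : ℂ :=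
  ∑ q ∈ pairsIn I, w q

theorem cluster_of_card_le_one (w : WithBot τ × WithBot τ → ℂ) {I : Finset (WithBot τ)}
    (hI : I.card ≤ 1) (y : τ → ℤ_[p]) : cluster w I y = 1 := by
  rw [cluster, pairsIn_eq_empty hI, Finset.prod_empty]

theorem weightSum_of_card_le_one (w : WithBot τ × WithBot τ → ℂ) {I : Finset (WithBot τ)}
    (hI : I.card ≤ 1) : weightSum w I = 0 := by
  rw [weightSum, pairsIn_eq_empty hI, Finset.sum_empty]

theorem norm_digitChart_sub_of_ne {a b : ZMod p} (hab : a ≠ b) (y z : ℤ_[p]) :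
    ‖digitChart a y - digitChart b z‖ = 1 := by
  refine le_antisymm (PadicInt.norm_le_one _) (not_lt.1 fun h => hab ?_)
  rwa [norm_lt_one_iff_toZMod_eq_zero, map_sub, toZMod_digitChart, toZMod_digitChart,
    sub_eq_zero] at h

theorem norm_digitChart_sub_self (a : ZMod p) (y z : ℤ_[p]) :
    ‖digitChart a y - digitChart a z‖ = (p : ℝ)⁻¹ * ‖y - z‖ := by
  rw [digitChart, digitChart, add_sub_add_left_eq_sub, ← mul_sub, norm_mul, PadicInt.norm_p]

omit [LinearOrder τ] in
theorem extendZero_digitChart (f : τ → ZMod p) (y : τ → ℤ_[p]) (k : WithBot τ) :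
    extendZero (fun i => digitChart (f i) (y i)) k =
      digitChart (extendZero f k) (extendZero y k) := by
  cases k with
  | bot => simp [extendZero, digitChart]
  | coe i => rfl

theorem cpow_neg_weightSum_mul_cluster (w : WithBot τ × WithBot τ → ℂ) (I : Finset (WithBot τ))
    (y : τ → ℤ_[p]) :
    (p : ℂ) ^ (-weightSum w I) * cluster w I y =
      ∏ q ∈ pairsIn I, cpw ((p : ℝ)⁻¹ * ‖extendZero y q.1 - extendZero y q.2‖) (w q) := by
  have hp0 : (p : ℝ)⁻¹ ≠ 0 := inv_ne_zero (by exact_mod_cast hp.out.ne_zero)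
  rw [← cpw_inv_natCast hp.out.ne_zero, weightSum, cpw_sum hp0, cluster, ← Finset.prod_mul_distrib]
  exact Finset.prod_congr rfl fun q _ => (cpw_mul (by positivity) (norm_nonneg _) _).symm

/-- Indices with distinct digits drop out because their points are at distance `1`. -/
theorem cluster_digitChart (w : WithBot τ × WithBot τ → ℂ) (I : Finset (WithBot τ))
    (f : τ → ZMod p) (y : τ → ℤ_[p]) :
    cluster w I (fun i => digitChart (f i) (y i)) =
      ∏ a, (p : ℂ) ^ (-weightSum w (fibre f I a)) * cluster w (fibre f I a) y := by
  simp only [cpow_neg_weightSum_mul_cluster]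
  rw [cluster, prod_pairsIn_fibre]
  refine Finset.prod_congr rfl fun q _ => ?_
  rw [extendZero_digitChart, extendZero_digitChart]
  split_ifs with hq
  · rw [hq, norm_digitChart_sub_self]
  · rw [norm_digitChart_sub_of_ne hq, cpw_one]

theorem cluster_digitChart_of_constOn (w : WithBot τ × WithBot τ → ℂ) {I : Finset (WithBot τ)}
    (hI : I.Nonempty) {f : τ → ZMod p} (hf : ConstOn f I) (y : τ → ℤ_[p]) :
    cluster w I (fun i => digitChart (f i) (y i)) =
      (p : ℂ) ^ (-weightSum w I) * cluster w I y := by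
  rw [cluster_digitChart,
    prod_fibre_of_constOn hf hI (g := fun J => (p : ℂ) ^ (-weightSum w J) * cluster w J y)]
  rw [weightSum_of_card_le_one w (by simp), cluster_of_card_le_one w (by simp)]
  simp

omit [LinearOrder τ] in
@[fun_prop]
theorem measurable_extendZero (k : WithBot τ) :
    Measurable fun y : τ → ℤ_[p] => extendZero y k := by
  cases k with
  | bot => exact measurable_const
  | coe i => exact measurable_pi_apply i

@[fun_prop]
theorem measurable_cluster (w : WithBot τ × WithBot τ → ℂ) (I : Finset (WithBot τ)) :
    Measurable (cluster (p := p) w I) := by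
  unfold cluster
  fun_prop

theorem dependsOn_cluster (w : WithBot τ × WithBot τ → ℂ) (I : Finset (WithBot τ)) :
    DependsOn (cluster (p := p) w I) (ordinary I : Set τ) := by
  intro y y' h
  have hI : ∀ k ∈ I, extendZero y k = extendZero y' k := by
    intro k hk
    cases k with
    | bot => rfl
    | coe i => exact h i (mem_ordinary.2 hk)
  refine Finset.prod_congr rfl fun q hq => ?_
  rw [mem_pairsIn] at hq
  rw [hI _ hq.1.1, hI _ hq.1.2]

end Integrand

section Ratio

variable [LinearOrder τ]

/-- The ratio of the geometric series attached to `I`. -/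
def ratio (p : ℕ) (w : WithBot τ × WithBot τ → ℂ) (I : Finset (WithBot τ)) : ℂ :=
  (p : ℂ) ^ (-((I.card : ℂ) - 1 + weightSum w I))

/-- The condition under which all cluster integrals of the weights `w` converge. -/
def IsConvergent (w : WithBot τ × WithBot τ → ℂ) : Prop :=
  ∀ I : Finset (WithBot τ), 2 ≤ I.card → 0 < (I.card : ℝ) - 1 + (weightSum w I).re

theorem norm_ratio_lt_one (hp : 1 < p) {w : WithBot τ × WithBot τ → ℂ} (hw : IsConvergent w)
    {I : Finset (WithBot τ)} (hI : 2 ≤ I.card) : ‖ratio p w I‖ < 1 := by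
  rw [ratio, Complex.norm_natCast_cpow_of_pos (by omega)]
  refine Real.rpow_lt_one_of_one_lt_of_neg (by exact_mod_cast hp) ?_
  simpa only [Complex.neg_re, Complex.add_re, Complex.sub_re, Complex.natCast_re, Complex.one_re,
    neg_neg_iff_pos] using hw I hI

theorem card_constOn_mul_eq_ratio [Fintype τ] [NeZero p] (w : WithBot τ × WithBot τ → ℂ)
    {I : Finset (WithBot τ)} (hI : I.Nonempty) :
    ((Finset.univ.filter fun f : τ → ZMod p => ConstOn f I).card : ℂ) *
      ((p : ℂ)⁻¹ ^ Fintype.card τ * (p : ℂ) ^ (-weightSum w I)) = ratio p w I := by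
  have hp0 : (p : ℂ) ≠ 0 := NeZero.ne _
  have hcard : ((Finset.univ.filter fun f : τ → ZMod p => ConstOn f I).card : ℂ) *
      (p : ℂ) ^ (I.card - 1) = (p : ℂ) ^ Fintype.card τ := by
    exact_mod_cast card_constOn_mul_pow hI
  have hsub : (I.card : ℂ) - 1 = ((I.card - 1 : ℕ) : ℂ) := by
    rw [Nat.cast_sub hI.card_pos, Nat.cast_one]
  rw [ratio, neg_add, Complex.cpow_add _ _ hp0, hsub, Complex.cpow_neg _ ((I.card - 1 : ℕ) : ℂ),
    Complex.cpow_natCast, ← mul_assoc, inv_pow, ← hcard]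
  have hne : ((Finset.univ.filter fun f : τ → ZMod p => ConstOn f I).card : ℂ) ≠ 0 :=
    left_ne_zero_of_mul (hcard ▸ pow_ne_zero _ hp0)
  field_simp

end Ratio

end Cluster

section ClusterIntegral

theorem le_of_forall_succ_le_mul_add {E : ℕ → ℝ≥0∞} {q C : ℝ≥0∞} (hq : q < 1) (h0 : E 0 = 0)
    (hrec : ∀ n, E (n + 1) ≤ q * E n + C) (n : ℕ) : E n ≤ (1 - q)⁻¹ * C := by
  have hfix : q * ((1 - q)⁻¹ * C) + C = (1 - q)⁻¹ * C := by
    have hC : (1 - q) * ((1 - q)⁻¹ * C) = C := by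
      rw [← mul_assoc, ENNReal.mul_inv_cancel (tsub_pos_of_lt hq).ne'
        (ENNReal.sub_ne_top ENNReal.one_ne_top), one_mul]
    nth_rw 2 [← hC]
    rw [← add_mul, add_tsub_cancel_of_le hq.le, one_mul]
  induction n with
  | zero => simp [h0]
  | succ n ih => exact ((hrec n).trans (by gcongr)).trans hfix.le

variable {p : ℕ} [hp : Fact p.Prime] {τ : Type*}

theorem enorm_natCast_inv_pow (n : ℕ) : ‖((p : ℂ)⁻¹ ^ n)‖ₑ = (p : ℝ≥0∞)⁻¹ ^ n := by
  rw [enorm_pow, enorm_eq_nnnorm, nnnorm_inv, ENNReal.coe_inv (by simpa using hp.out.ne_zero)]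
  simp

section Separated

/-- The points whose coordinates with index in `I` are not all congruent modulo `p ^ n`: an
exhaustion, on which the cluster integral of `I` can be computed recursively. -/
def separated (I : Finset (WithBot τ)) (n : ℕ) : Set (τ → ℤ_[p]) :=
  {y | ∃ k ∈ I, ∃ l ∈ I, ((p : ℝ)⁻¹) ^ n < ‖extendZero y k - extendZero y l‖}

theorem measurableSet_separated (I : Finset (WithBot τ)) (n : ℕ) :
    MeasurableSet (separated (p := p) I n) := by
  have hunion : separated (p := p) I n = ⋃ k ∈ I, ⋃ l ∈ I,
      {y | ((p : ℝ)⁻¹) ^ n < ‖extendZero y k - extendZero y l‖} := by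
    ext y
    simp [separated]
  rw [hunion]
  exact Finset.measurableSet_biUnion _ fun k _ => Finset.measurableSet_biUnion _ fun l _ =>
    measurableSet_lt measurable_const (by fun_prop)

theorem digitChart_mem_separated {f : τ → ZMod p} {I : Finset (WithBot τ)} (h : ConstOn f I)
    (n : ℕ) (y : τ → ℤ_[p]) :
    (fun i => digitChart (f i) (y i)) ∈ separated I (n + 1) ↔ y ∈ separated I n := by
  have hp0 : (0 : ℝ) < (p : ℝ)⁻¹ := inv_pos.2 (by exact_mod_cast hp.out.pos)
  refine exists_congr fun k => and_congr_right fun hk => exists_congr fun l =>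
    and_congr_right fun hl => ?_
  rw [extendZero_digitChart, extendZero_digitChart, h k hk l hl, norm_digitChart_sub_self,
    pow_succ', mul_lt_mul_iff_right₀ hp0]

theorem separated_zero (I : Finset (WithBot τ)) : separated (p := p) I 0 = ∅ := by
  refine Set.eq_empty_of_forall_notMem ?_
  rintro y ⟨k, _, l, _, h⟩
  rw [pow_zero] at h
  exact h.not_ge (PadicInt.norm_le_one _)

theorem monotone_separated (I : Finset (WithBot τ)) : Monotone (separated (p := p) I) := by
  rintro m n hmn y ⟨k, hk, l, hl, h⟩
  refine ⟨k, hk, l, hl, lt_of_le_of_lt (pow_le_pow_of_le_one (by positivity) ?_ hmn) h⟩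
  exact inv_le_one_of_one_le₀ (by exact_mod_cast hp.out.one_lt.le)

theorem mem_iUnion_separated {I : Finset (WithBot τ)} {y : τ → ℤ_[p]} {k l : WithBot τ}
    (hk : k ∈ I) (hl : l ∈ I) (hkl : extendZero y k ≠ extendZero y l) :
    y ∈ ⋃ n, separated I n := by
  obtain ⟨n, hn⟩ := exists_pow_lt_of_lt_one (norm_pos_iff.2 (sub_ne_zero.2 hkl))
    (inv_lt_one_of_one_lt₀ (by exact_mod_cast hp.out.one_lt : (1 : ℝ) < p))
  exact Set.mem_iUnion.2 ⟨n, k, hk, l, hl, hn⟩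

end Separated

variable [LinearOrder τ]

theorem support_cluster_subset (w : WithBot τ × WithBot τ → ℂ) {I : Finset (WithBot τ)}
    (hI : 2 ≤ I.card) : (cluster (p := p) w I).support ⊆ ⋃ n, separated I n := by
  intro y hy
  obtain ⟨k, hk, l, hl, hkl⟩ := Finset.one_lt_card.1 hI
  wlog hlt : k < l generalizing k l
  · exact this l hl k hk hkl.symm (lt_of_le_of_ne (not_lt.1 hlt) hkl.symm)
  refine mem_iUnion_separated hk hl fun h => hy ?_
  exact Finset.prod_eq_zero (i := (k, l)) (mem_pairsIn.2 ⟨⟨hk, hl⟩, hlt⟩) (by simp [h, cpw_zero])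

variable [Fintype τ]

variable (p τ) in
/-- The Haar probability measure of `ℤ_p^τ`. -/
abbrev haarPi : Measure (τ → ℤ_[p]) := Measure.pi fun _ : τ => haarZp p

omit [LinearOrder τ] in
theorem lintegral_haarPi [DecidableEq τ] {G : (τ → ℤ_[p]) → ℝ≥0∞} (hG : Measurable G) :
    ∫⁻ y, G y ∂haarPi p τ = ∑ f : τ → ZMod p,
      (p : ℝ≥0∞)⁻¹ ^ Fintype.card τ * ∫⁻ y, G (fun i => digitChart (f i) (y i)) ∂haarPi p τ := by
  have hp0 : (p : ℝ≥0) ≠ 0 := by exact_mod_cast hp.out.ne_zero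
  rw [haarPi, lintegral_pi_eq_sum_chart (ρ := fun _ _ => (p : ℝ≥0)⁻¹) measurable_digitChart
    (fun _ => measurable_const) haarZp_eq_sum_map_withDensity hG]
  refine Finset.sum_congr rfl fun f _ => ?_
  have hm : Measurable fun y : τ → ℤ_[p] => G fun i => digitChart (f i) (y i) :=
    hG.comp (measurable_pi_chart measurable_digitChart f)
  rw [lintegral_const_mul _ hm, Finset.prod_const, Finset.card_univ, ENNReal.coe_pow,
    ENNReal.coe_inv hp0, ENNReal.coe_natCast]

omit [LinearOrder τ] in
theorem integral_haarPi [DecidableEq τ] {G : (τ → ℤ_[p]) → ℂ} (hG : Measurable G)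
    (hint : ∀ f : τ → ZMod p,
      Integrable (fun y => G fun i => digitChart (f i) (y i)) (haarPi p τ)) :
    ∫ y, G y ∂haarPi p τ = ∑ f : τ → ZMod p,
      (p : ℂ)⁻¹ ^ Fintype.card τ * ∫ y, G (fun i => digitChart (f i) (y i)) ∂haarPi p τ := by
  rw [haarPi, integral_pi_eq_sum_chart (ρ := fun _ _ => (p : ℝ≥0)⁻¹) measurable_digitChart
    (fun _ => measurable_const) haarZp_eq_sum_map_withDensity hG.stronglyMeasurable
    fun f => by simpa only [NNReal.smul_def] using! (hint f).smul (_ : ℝ)]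
  refine Finset.sum_congr rfl fun f _ => ?_
  simp only [NNReal.smul_def]
  rw [integral_smul, Complex.real_smul]
  simp

theorem integrable_cluster_digitChart {w : WithBot τ × WithBot τ → ℂ} {I : Finset (WithBot τ)}
    {f : τ → ZMod p} (hint : ∀ a, Integrable (cluster w (fibre f I a)) (haarPi p τ)) :
    Integrable (fun y => cluster w I fun i => digitChart (f i) (y i)) (haarPi p τ) := by
  simp only [cluster_digitChart]
  exact integrable_pi_prod_of_dependsOn (disjoint_ordinary_fibre f I)
    (fun a => (measurable_cluster w _).const_mul _)
    (fun a y y' h => by simp only [dependsOn_cluster w (fibre f I a) h])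
    fun a => (hint a).const_mul _

/-- The integral of the absolute value of the integrand of the cluster integral, truncated to the
points separated modulo `p ^ n`. -/
def truncatedIntegral (p : ℕ) [Fact p.Prime] (w : WithBot τ × WithBot τ → ℂ)
    (I : Finset (WithBot τ)) (n : ℕ) : ℝ≥0∞ :=
  ∫⁻ y in separated I n, ‖cluster w I y‖ₑ ∂haarPi p τ

theorem lintegral_enorm_cluster_eq_iSup (w : WithBot τ × WithBot τ → ℂ) {I : Finset (WithBot τ)}
    (hI : 2 ≤ I.card) :
    ∫⁻ y, ‖cluster w I y‖ₑ ∂haarPi p τ = ⨆ n, truncatedIntegral p w I n := by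
  have hsupp : (fun y => ‖cluster (p := p) w I y‖ₑ).support ⊆ ⋃ n, separated I n := by
    simpa [Function.support, enorm_ne_zero] using support_cluster_subset (p := p) w hI
  rw [← setLIntegral_eq_of_support_subset hsupp,
    setLIntegral_iUnion_of_directed _ (monotone_separated I).directed_le]
  rfl

theorem lintegral_indicator_digitChart_of_constOn (w : WithBot τ × WithBot τ → ℂ)
    {I : Finset (WithBot τ)} (hI : I.Nonempty) {f : τ → ZMod p} (hf : ConstOn f I) (n : ℕ) :
    ∫⁻ y, (separated I (n + 1)).indicator (fun y => ‖cluster w I y‖ₑ)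
        (fun i => digitChart (f i) (y i)) ∂haarPi p τ =
      ‖(p : ℂ) ^ (-weightSum w I)‖ₑ * truncatedIntegral p w I n := by
  rw [truncatedIntegral, ← lintegral_const_mul _ (measurable_cluster w I).enorm,
    ← lintegral_indicator (measurableSet_separated I n)]
  refine lintegral_congr fun y => ?_
  by_cases hy : y ∈ separated I n
  · rw [Set.indicator_of_mem hy, Set.indicator_of_mem ((digitChart_mem_separated hf n y).2 hy),
      cluster_digitChart_of_constOn w hI hf, enorm_mul]
  · rw [Set.indicator_of_notMem hy,
      Set.indicator_of_notMem (mt (digitChart_mem_separated hf n y).1 hy)]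

theorem truncatedIntegral_succ_le (w : WithBot τ × WithBot τ → ℂ) {I : Finset (WithBot τ)}
    (hI : I.Nonempty) (n : ℕ) :
    truncatedIntegral p w I (n + 1) ≤ ‖ratio p w I‖ₑ * truncatedIntegral p w I n +
      ∑ f : τ → ZMod p with ¬ConstOn f I, (p : ℝ≥0∞)⁻¹ ^ Fintype.card τ *
        ∫⁻ y, ‖cluster w I (fun i => digitChart (f i) (y i))‖ₑ ∂haarPi p τ := by
  have hsep := measurableSet_separated (p := p) I (n + 1)
  rw [truncatedIntegral, ← lintegral_indicator hsep,
    lintegral_haarPi ((measurable_cluster w I).enorm.indicator hsep),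
    ← Finset.sum_filter_add_sum_filter_not Finset.univ fun f => ConstOn f I]
  gcongr with f _ y
  · rw [Finset.sum_congr rfl fun f hf => by
      rw [lintegral_indicator_digitChart_of_constOn w hI (Finset.mem_filter.1 hf).2],
      Finset.sum_const, nsmul_eq_mul, ← card_constOn_mul_eq_ratio w hI, enorm_mul, enorm_mul,
      enorm_natCast_inv_pow, ← mul_assoc, ← mul_assoc, ← mul_assoc]
    simp [enorm_eq_nnnorm]
  · exact Set.indicator_le_self _ (fun y => ‖cluster w I y‖ₑ) _

theorem integrable_cluster {w : WithBot τ × WithBot τ → ℂ} (hw : IsConvergent w)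
    (I : Finset (WithBot τ)) : Integrable (cluster w I) (haarPi p τ) := by
  induction I using Finset.strongInduction with
  | H I ih =>
  rcases Nat.lt_or_ge I.card 2 with hI | hI
  · exact (integrable_const 1).congr <| .of_forall fun y =>
      (cluster_of_card_le_one w (by omega) y).symm
  have hq : ‖ratio p w I‖ₑ < 1 := by
    rw [← ofReal_norm, ENNReal.ofReal_lt_one]
    exact norm_ratio_lt_one hp.out.one_lt hw hI
  set C : ℝ≥0∞ := ∑ f : τ → ZMod p with ¬ConstOn f I, (p : ℝ≥0∞)⁻¹ ^ Fintype.card τ *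
    ∫⁻ y, ‖cluster w I (fun i => digitChart (f i) (y i))‖ₑ ∂haarPi p τ
  have hC : C < ∞ := by
    refine ENNReal.sum_lt_top.2 fun f hf => ENNReal.mul_lt_top ?_ ?_
    · exact ENNReal.pow_lt_top (ENNReal.inv_lt_top.2 (by exact_mod_cast hp.out.pos))
    · exact (integrable_cluster_digitChart fun a =>
        ih _ (fibre_ssubset_of_not_constOn (Finset.mem_filter.1 hf).2 a)).2
  have hbound (n) : truncatedIntegral p w I n ≤ (1 - ‖ratio p w I‖ₑ)⁻¹ * C :=
    le_of_forall_succ_le_mul_add hq (by simp [truncatedIntegral, separated_zero])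
      (truncatedIntegral_succ_le w (Finset.card_pos.1 (by omega))) n
  refine ⟨(measurable_cluster w I).aestronglyMeasurable, ?_⟩
  rw [hasFiniteIntegral_iff_enorm, lintegral_enorm_cluster_eq_iSup w hI]
  exact (iSup_le hbound).trans_lt
    (ENNReal.mul_lt_top (ENNReal.inv_lt_top.2 (tsub_pos_of_lt hq)) hC)

/-- The cluster integral `∫ ∏_{i < j in I} |y_i - y_j| ^ w_{ij} dy` over `ℤ_p^τ`, where
`y_⊥ = 0`. -/
def clusterIntegral (p : ℕ) [Fact p.Prime] (w : WithBot τ × WithBot τ → ℂ)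
    (I : Finset (WithBot τ)) : ℂ :=
  ∫ y, cluster w I y ∂haarPi p τ

theorem clusterIntegral_of_card_le_one (w : WithBot τ × WithBot τ → ℂ) {I : Finset (WithBot τ)}
    (hI : I.card ≤ 1) : clusterIntegral p w I = 1 := by
  simp only [clusterIntegral, cluster_of_card_le_one w hI, integral_const, probReal_univ, one_smul]

theorem integral_cluster_digitChart (w : WithBot τ × WithBot τ → ℂ) (I : Finset (WithBot τ))
    (f : τ → ZMod p) :
    ∫ y, cluster w I (fun i => digitChart (f i) (y i)) ∂haarPi p τ =
      ∏ a, (p : ℂ) ^ (-weightSum w (fibre f I a)) * clusterIntegral p w (fibre f I a) := by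
  simp only [cluster_digitChart]
  rw [integral_pi_prod_of_dependsOn (disjoint_ordinary_fibre f I)
    (fun a => (measurable_cluster w _).const_mul _)
    (fun a y y' h => by simp only [dependsOn_cluster w (fibre f I a) h])]
  simp only [integral_const_mul, clusterIntegral]

theorem integral_cluster_digitChart_of_constOn (w : WithBot τ × WithBot τ → ℂ)
    {I : Finset (WithBot τ)} (hI : I.Nonempty) {f : τ → ZMod p} (hf : ConstOn f I) :
    ∫ y, cluster w I (fun i => digitChart (f i) (y i)) ∂haarPi p τ =
      (p : ℂ) ^ (-weightSum w I) * clusterIntegral p w I := by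
  simp only [cluster_digitChart_of_constOn w hI hf, integral_const_mul, clusterIntegral]

/-- Summing over the first digits, the constant digit families reproduce the integral with the
factor `ratio p w I`. -/
theorem clusterIntegral_eq {w : WithBot τ × WithBot τ → ℂ} (hw : IsConvergent w)
    {I : Finset (WithBot τ)} (hI : 2 ≤ I.card) :
    clusterIntegral p w I = (1 - ratio p w I)⁻¹ *
      ∑ f : τ → ZMod p with ¬ConstOn f I, (p : ℂ)⁻¹ ^ Fintype.card τ *
      ∏ a, (p : ℂ) ^ (-weightSum w (fibre f I a)) * clusterIntegral p w (fibre f I a) := by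
  have hne : I.Nonempty := Finset.card_pos.1 (by omega)
  have hq : 1 - ratio p w I ≠ 0 := sub_ne_zero.2 fun h => by
    simpa [← h] using norm_ratio_lt_one hp.out.one_lt hw hI
  have hsum : clusterIntegral p w I = _ :=
    integral_haarPi (measurable_cluster w I) fun f : τ → ZMod p =>
      integrable_cluster_digitChart fun a => integrable_cluster hw (fibre f I a)
  rw [← Finset.sum_filter_add_sum_filter_not Finset.univ fun f => ConstOn f I,
    Finset.sum_congr rfl fun f hf => by
      rw [integral_cluster_digitChart_of_constOn w hne (Finset.mem_filter.1 hf).2],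
    Finset.sum_const, nsmul_eq_mul, ← mul_assoc, ← mul_assoc, mul_assoc (Nat.cast _),
    card_constOn_mul_eq_ratio w hne] at hsum
  rw [eq_inv_mul_iff_mul_eq₀ hq, sub_mul, one_mul, sub_eq_iff_eq_add']
  simpa only [integral_cluster_digitChart] using hsum

theorem clusterIntegral_mem {S : Type*} (R : Subring (S → ℂ)) {w : S → WithBot τ × WithBot τ → ℂ}
    (hw : ∀ s, IsConvergent (w s)) (hinv : (fun _ => (p : ℂ)⁻¹) ∈ R)
    (hweight : ∀ I, (fun s => (p : ℂ) ^ (-weightSum (w s) I)) ∈ R)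
    (hratio : ∀ I, 2 ≤ I.card → (fun s => (1 - ratio p (w s) I)⁻¹) ∈ R)
    (I : Finset (WithBot τ)) : (fun s => clusterIntegral p (w s) I) ∈ R := by
  induction I using Finset.strongInduction with
  | H I ih =>
  rcases Nat.lt_or_ge I.card 2 with hI | hI
  · have hone : (fun s => clusterIntegral p (w s) I) = 1 :=
      funext fun s => clusterIntegral_of_card_le_one _ (by omega)
    exact hone ▸ R.one_mem
  · have hrec : (fun s => clusterIntegral p (w s) I) = (fun s => (1 - ratio p (w s) I)⁻¹) *
        ∑ f : τ → ZMod p with ¬ConstOn f I, (fun _ => (p : ℂ)⁻¹) ^ Fintype.card τ *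
        ∏ a, (fun s => (p : ℂ) ^ (-weightSum (w s) (fibre f I a))) *
          (fun s => clusterIntegral p (w s) (fibre f I a)) := by
      funext s
      rw [clusterIntegral_eq (hw s) hI]
      simp only [Pi.mul_apply, Finset.sum_apply, Finset.prod_apply, Pi.pow_apply]
    rw [hrec]
    refine R.mul_mem (hratio I hI) (R.sum_mem fun f hf => R.mul_mem (R.pow_mem hinv _)
      (R.prod_mem fun a _ => R.mul_mem (hweight _) (ih _ ?_)))
    exact fibre_ssubset_of_not_constOn (Finset.mem_filter.1 hf).2 a

end ClusterIntegral

/-! ### Residue classes of the projective line -/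

section PairsIn

variable {τ : Type*} [Fintype τ] {M : Type*}

theorem prod_withBot [CommMonoid M] (h : WithBot τ → M) : ∏ k, h k = h ⊥ * ∏ i : τ, h i :=
  Fintype.prod_option h

variable [LinearOrder τ]

theorem prod_prod_ite_lt [CommMonoid M] (g : τ → τ → M) :
    ∏ i, ∏ j, (if i < j then g i j else 1) = ∏ q : {q : τ × τ // q.1 < q.2}, g q.1.1 q.1.2 := by
  rw [← Fintype.prod_prod_type' fun i j => if i < j then g i j else 1, ← Finset.prod_filter]
  exact Finset.prod_subtype _ (by simp) _

theorem prod_pairsIn [CommMonoid M] (I : Finset (WithBot τ)) (g : WithBot τ × WithBot τ → M) :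
    ∏ q ∈ pairsIn I, g q = (if ⊥ ∈ I then ∏ i ∈ ordinary I, g (⊥, (i : WithBot τ)) else 1) *
      ∏ q : {q : τ × τ // q.1 < q.2} with q.1.1 ∈ ordinary I ∧ q.1.2 ∈ ordinary I,
        g (q.1.1, q.1.2) := by
  have hiter : ∏ q ∈ pairsIn I, g q =
      ∏ k, ∏ l, if (k ∈ I ∧ l ∈ I) ∧ k < l then g (k, l) else 1 := by
    rw [← Fintype.prod_prod_type', ← Finset.prod_filter]
    refine Finset.prod_congr ?_ fun q _ => rfl
    ext q
    simp [mem_pairsIn]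
  rw [hiter]
  simp only [prod_withBot]
  congr 1
  · simp only [lt_self_iff_false, and_false, if_false, one_mul, WithBot.bot_lt_coe, and_true]
    split_ifs with hb
    · rw [← Finset.prod_filter]
      refine Finset.prod_congr ?_ fun _ _ => rfl
      ext i
      simp [mem_ordinary, hb]
    · simp [hb]
  · simp only [not_lt_bot, and_false, if_false, one_mul, WithBot.coe_lt_coe]
    rw [Finset.prod_filter, ← prod_prod_ite_lt fun i j : τ =>
      if i ∈ ordinary I ∧ j ∈ ordinary I then g (i, j) else 1]
    simp only [mem_ordinary, and_comm, ite_and]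

theorem sum_pairsIn [AddCommMonoid M] (I : Finset (WithBot τ)) (g : WithBot τ × WithBot τ → M) :
    ∑ q ∈ pairsIn I, g q = (if ⊥ ∈ I then ∑ i ∈ ordinary I, g (⊥, (i : WithBot τ)) else 0) +
      ∑ q : {q : τ × τ // q.1 < q.2} with q.1.1 ∈ ordinary I ∧ q.1.2 ∈ ordinary I,
        g (q.1.1, q.1.2) :=
  prod_pairsIn (M := Multiplicative M) I g

end PairsIn

section ResidueClasses

variable {p : ℕ} {N : ℕ}

/-- The residue classes of `0`, `1` and `∞`, the fixed points of the integrand. -/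
def Marked (a : Option (ZMod p)) : Prop := a = none ∨ a = some 0 ∨ a = some 1

instance decidableMarked (a : Option (ZMod p)) : Decidable (Marked a) := by
  unfold Marked; infer_instance

/-- The exponent of the distance to the point `0`, `1` or `∞` in its residue class; a junk value
for the other classes. -/
def markWeight (a : Option (ZMod p)) (s : Idx N → ℂ) (i : T N) : ℂ :=
  match a with
  | none => -(2 + c1 s i + cLast s i + (∑ q : Pairs N with q.1.1 = i, cPair s q) +
      ∑ q : Pairs N with q.1.2 = i, cPair s q)
  | some a => if a = 0 then c1 s i else cLast s i

/-- The weights of the clusters in the residue class `a`. -/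
def classWeight (a : Option (ZMod p)) (s : Idx N → ℂ) : WithBot (T N) × WithBot (T N) → ℂ
  | (⊥, (i : T N)) => markWeight a s i
  | ((i : T N), (j : T N)) => if h : i < j then cPair s ⟨(i, j), h⟩ else 0
  | (_, ⊥) => 0

theorem classWeight_bot (a : Option (ZMod p)) (s : Idx N → ℂ) (i : T N) :
    classWeight a s (⊥, (i : WithBot (T N))) = markWeight a s i := rfl

theorem classWeight_coe_coe (a : Option (ZMod p)) (s : Idx N → ℂ) (q : Pairs N) :
    classWeight a s ((q.1.1 : WithBot (T N)), (q.1.2 : WithBot (T N))) = cPair s q :=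
  dif_pos q.2

variable {τ : Type*} [Fintype τ]

/-- The indices in the residue class `a`, with `⊥` for the point `0`, `1` or `∞`. -/
def classSet (f : τ → Option (ZMod p)) (a : Option (ZMod p)) : Finset (WithBot τ) :=
  let S := (Finset.univ.filter fun i => f i = a).map ⟨WithBot.some, WithBot.coe_injective⟩
  if Marked a then S.cons ⊥ (by simp [S]) else S

theorem bot_mem_classSet {f : τ → Option (ZMod p)} {a : Option (ZMod p)} :
    ⊥ ∈ classSet f a ↔ Marked a := by
  by_cases h : Marked a <;> simp [classSet, h]

theorem coe_mem_classSet {f : τ → Option (ZMod p)} {a : Option (ZMod p)} {i : τ} :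
    (i : WithBot τ) ∈ classSet f a ↔ f i = a := by
  by_cases h : Marked a <;> simp [classSet, h]

theorem ordinary_classSet (f : τ → Option (ZMod p)) (a : Option (ZMod p)) :
    ordinary (classSet f a) = Finset.univ.filter fun i => f i = a := by
  ext i
  simp [mem_ordinary, coe_mem_classSet]

theorem disjoint_ordinary_classSet (f : τ → Option (ZMod p)) :
    Pairwise fun a b => Disjoint (ordinary (classSet f a)) (ordinary (classSet f b)) := by
  intro a b hab
  simp only [ordinary_classSet]
  exact Finset.disjoint_filter.2 fun i _ hi hj => hab (hi.symm.trans hj)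

end ResidueClasses

section ZeroExtension

variable {p : ℕ} [hp : Fact p.Prime] {N : ℕ}

/-- The integrand, extended by `0` to the set `Lam`. -/
def integrandZero (s : Idx N → ℂ) (x : T N → ℚ_[p]) : ℂ :=
  (∏ i, cpw ‖x i‖ (c1 s i) * cpw ‖1 - x i‖ (cLast s i)) *
    ∏ q : Pairs N, cpw ‖x q.1.1 - x q.1.2‖ (cPair s q)

theorem mem_Lam {x : T N → ℚ_[p]} : x ∈ Lam p N ↔
    (∃ i, x i = 0 ∨ 1 - x i = 0) ∨ ∃ q : Pairs N, x q.1.1 - x q.1.2 = 0 := by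
  simp [Lam, Finset.prod_eq_zero_iff]

theorem integrandZero_of_mem (s : Idx N → ℂ) {x : T N → ℚ_[p]} (hx : x ∈ Lam p N) :
    integrandZero s x = 0 := by
  rcases mem_Lam.1 hx with ⟨i, hi⟩ | ⟨q, hq⟩
  · refine mul_eq_zero_of_left (Finset.prod_eq_zero (Finset.mem_univ i) ?_) _
    rcases hi with hi | hi <;> simp [hi, cpw_zero]
  · refine mul_eq_zero_of_right _ (Finset.prod_eq_zero (Finset.mem_univ q) ?_)
    simp [hq, cpw_zero]

theorem integrandZero_of_notMem (s : Idx N → ℂ) {x : T N → ℚ_[p]} (hx : x ∉ Lam p N) :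
    integrandZero s x = integrand p s x := by
  simp only [mem_Lam, not_or, not_exists] at hx
  refine congrArg₂ (· * ·) (Finset.prod_congr rfl fun i _ => ?_)
    (Finset.prod_congr rfl fun q _ => ?_)
  · rw [cpw_of_ne_zero (norm_ne_zero_iff.2 (hx.1 i).1),
      cpw_of_ne_zero (norm_ne_zero_iff.2 (hx.1 i).2)]
  · rw [cpw_of_ne_zero (norm_ne_zero_iff.2 (hx.2 q))]

theorem indicator_integrand (s : Idx N → ℂ) :
    (Lam p N)ᶜ.indicator (integrand p s) = integrandZero s := by
  funext x
  by_cases hx : x ∈ Lam p N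
  · rw [Set.indicator_of_notMem (not_not.2 hx), integrandZero_of_mem s hx]
  · rw [Set.indicator_of_mem hx, integrandZero_of_notMem s hx]

theorem measurable_integrandZero (s : Idx N → ℂ) : Measurable (integrandZero (p := p) s) := by
  unfold integrandZero
  fun_prop

theorem measurableSet_Lam : MeasurableSet (Lam p N) :=
  measurableSet_eq_fun (by fun_prop) measurable_const

end ZeroExtension

section ProjectiveCharts

variable {p : ℕ} [hp : Fact p.Prime]

/-- The height `max 1 ‖x‖` of the point `x = projChart a y`. In terms of it, all distances between
the points of two charts are given by a single formula. -/
def chartHeight (a : Option (ZMod p)) (y : ℤ_[p]) : ℝ :=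
  if a = none then ((p : ℝ)⁻¹ * ‖y‖)⁻¹ else 1

theorem inv_mul_norm_lt_one (y : ℤ_[p]) : (p : ℝ)⁻¹ * ‖y‖ < 1 := by
  have hp1 : (p : ℝ)⁻¹ < 1 := inv_lt_one_of_one_lt₀ (by exact_mod_cast hp.out.one_lt)
  exact mul_lt_one_of_nonneg_of_lt_one_left (by positivity) hp1 (PadicInt.norm_le_one y)

theorem inv_mul_norm_pos {y : ℤ_[p]} (hy : y ≠ 0) : 0 < (p : ℝ)⁻¹ * ‖y‖ :=
  mul_pos (inv_pos.2 (by exact_mod_cast hp.out.pos)) (norm_pos_iff.2 hy)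

theorem chartHeight_nonneg (a : Option (ZMod p)) (y : ℤ_[p]) : 0 ≤ chartHeight a y := by
  unfold chartHeight
  split_ifs <;> positivity

theorem chartHeight_ne_zero {a : Option (ZMod p)} {y : ℤ_[p]} (hy : a = none → y ≠ 0) :
    chartHeight a y ≠ 0 := by
  unfold chartHeight
  split_ifs with ha
  · exact inv_ne_zero (inv_mul_norm_pos (hy ha)).ne'
  · exact one_ne_zero

theorem projDensity_eq (a : Option (ZMod p)) (y : ℤ_[p]) :
    (projDensity a y : ℝ) = (p : ℝ)⁻¹ * chartHeight a y ^ 2 := by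
  have hp0 : (p : ℝ) ≠ 0 := by exact_mod_cast hp.out.ne_zero
  cases a with
  | none =>
    simp only [projDensity, chartHeight]
    push_cast
    field_simp
  | some a => simp [projDensity, chartHeight]

theorem norm_projChart_none (y : ℤ_[p]) : ‖projChart none y‖ = ((p : ℝ)⁻¹ * ‖y‖)⁻¹ := by
  simp [projChart]

theorem norm_sub_eq_left_of_norm_lt {x y : ℚ_[p]} (h : ‖y‖ < ‖x‖) : ‖x - y‖ = ‖x‖ := by
  rw [sub_eq_add_neg, Padic.add_eq_max_of_ne (by rw [norm_neg]; exact h.ne'), norm_neg,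
    max_eq_left h.le]

theorem norm_projChart_none_sub {y : ℤ_[p]} (hy : y ≠ 0) {x : ℚ_[p]} (hx : ‖x‖ ≤ 1) :
    ‖projChart none y - x‖ = ((p : ℝ)⁻¹ * ‖y‖)⁻¹ := by
  have hlt : ‖x‖ < ‖projChart none y‖ := by
    rw [norm_projChart_none]
    exact hx.trans_lt ((one_lt_inv₀ (inv_mul_norm_pos hy)).2 (inv_mul_norm_lt_one y))
  rw [← norm_projChart_none, norm_sub_eq_left_of_norm_lt hlt]

theorem norm_projChart_some_le (a : ZMod p) (y : ℤ_[p]) : ‖projChart (some a) y‖ ≤ 1 :=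
  PadicInt.norm_le_one (digitChart a y)

theorem norm_projChart_some_sub (a b : ZMod p) (y z : ℤ_[p]) :
    ‖projChart (some a) y - projChart (some b) z‖ = ‖digitChart a y - digitChart b z‖ := by
  rw [PadicInt.norm_def]
  simp [projChart]

theorem norm_projChart_none_sub_none {y z : ℤ_[p]} (hy : y ≠ 0) (hz : z ≠ 0) :
    ‖projChart none y - projChart none z‖ =
      ((p : ℝ)⁻¹ * ‖y - z‖) * (((p : ℝ)⁻¹ * ‖y‖)⁻¹ * ((p : ℝ)⁻¹ * ‖z‖)⁻¹) := by
  have hp0 : (p : ℚ_[p]) ≠ 0 := by exact_mod_cast hp.out.ne_zero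
  have hpy : p * (y : ℚ_[p]) ≠ 0 := mul_ne_zero hp0 (by simpa using hy)
  have hpz : p * (z : ℚ_[p]) ≠ 0 := mul_ne_zero hp0 (by simpa using hz)
  rw [projChart, projChart, inv_sub_inv hpy hpz, ← mul_sub, norm_div, norm_mul, norm_mul, norm_mul,
    norm_mul, Padic.norm_p, norm_sub_rev, div_eq_mul_inv, mul_inv, PadicInt.norm_def,
    PadicInt.norm_def, PadicInt.norm_def, PadicInt.coe_sub]

theorem norm_projChart_sub_projChart {a b : Option (ZMod p)} {y z : ℤ_[p]}
    (hy : a = none → y ≠ 0) (hz : b = none → z ≠ 0) :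
    ‖projChart a y - projChart b z‖ =
      (if a = b then (p : ℝ)⁻¹ * ‖y - z‖ else 1) * (chartHeight a y * chartHeight b z) := by
  cases a with
  | none =>
    cases b with
    | none => simpa [chartHeight] using norm_projChart_none_sub_none (hy rfl) (hz rfl)
    | some b =>
      simpa [chartHeight] using norm_projChart_none_sub (hy rfl) (norm_projChart_some_le b z)
  | some a =>
    cases b with
    | none =>
      rw [norm_sub_rev]
      simpa [chartHeight] using norm_projChart_none_sub (hz rfl) (norm_projChart_some_le a y)
    | some b =>
      rw [norm_projChart_some_sub]
      by_cases hab : a = b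
      · simp [hab, norm_digitChart_sub_self, chartHeight]
      · simp [hab, norm_digitChart_sub_of_ne hab, chartHeight]

theorem norm_projChart_eq {a : Option (ZMod p)} {y : ℤ_[p]} (hy : a = none → y ≠ 0) :
    ‖projChart a y‖ = (if a = some 0 then (p : ℝ)⁻¹ * ‖y‖ else 1) * chartHeight a y := by
  simpa [projChart, digitChart, chartHeight] using
    norm_projChart_sub_projChart (b := some 0) (z := 0) hy (by simp)

theorem norm_one_sub_projChart_eq {a : Option (ZMod p)} {y : ℤ_[p]} (hy : a = none → y ≠ 0) :
    ‖1 - projChart a y‖ = (if a = some 1 then (p : ℝ)⁻¹ * ‖y‖ else 1) * chartHeight a y := by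
  have := Fact.mk hp.out.one_lt
  rw [norm_sub_rev]
  simpa [projChart, digitChart, chartHeight, ZMod.val_one] using
    norm_projChart_sub_projChart (b := some 1) (z := 0) hy (by simp)

theorem prod_cpw_fiberwise {ι κ : Type*} [Fintype ι] [Fintype κ] [DecidableEq κ] {u : κ → ℝ}
    (hu : ∀ k, u k ≠ 0) (π : ι → κ) (s : ι → ℂ) :
    ∏ q, cpw (u (π q)) (s q) = ∏ k, cpw (u k) (∑ q with π q = k, s q) := by
  rw [← Finset.prod_fiberwise Finset.univ π]
  refine Finset.prod_congr rfl fun k _ => ?_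
  rw [cpw_sum (hu k)]
  exact Finset.prod_congr rfl fun q hq => by rw [(Finset.mem_filter.1 hq).2]

variable {N : ℕ}

theorem projDensity_mul_factor (s : Idx N → ℂ) (i : T N) {a : Option (ZMod p)} {y : ℤ_[p]}
    (hy : a = none → y ≠ 0) :
    (projDensity a y : ℂ) * (cpw ‖projChart a y‖ (c1 s i) * cpw ‖1 - projChart a y‖ (cLast s i)) *
      (cpw (chartHeight a y) (∑ q : Pairs N with q.1.1 = i, cPair s q) *
        cpw (chartHeight a y) (∑ q : Pairs N with q.1.2 = i, cPair s q)) =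
    (p : ℂ)⁻¹ * if Marked a then cpw ((p : ℝ)⁻¹ * ‖y‖) (markWeight a s i) else 1 := by
  have hdensity : (projDensity a y : ℂ) = (p : ℂ)⁻¹ * cpw (chartHeight a y) 2 := by
    have hreal := congrArg Complex.ofReal (projDensity_eq a y)
    rw [cpw_of_ne_zero (chartHeight_ne_zero hy)]
    push_cast at hreal
    rw [Complex.cpow_ofNat]
    exact hreal
  have h0 : (0 : ℝ) ≤ (p : ℝ)⁻¹ * ‖y‖ := by positivity
  rw [hdensity, norm_projChart_eq hy, norm_one_sub_projChart_eq hy, mul_assoc, mul_assoc]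
  congr 1
  rcases a with _ | a
  · rw [if_pos (show Marked none from Or.inl rfl)]
    simp only [reduceCtorEq, if_false, one_mul, ← cpw_add, chartHeight, if_true, cpw_inv h0]
    rw [markWeight]
    congr 1
    ring
  · simp only [chartHeight, reduceCtorEq, if_false, mul_one, cpw_one, one_mul, Option.some.injEq,
      Marked, markWeight, false_or]
    by_cases ha0 : a = 0
    · simp [ha0, cpw_one]
    · by_cases ha1 : a = 1 <;> simp [ha0, ha1, cpw_one]

theorem integrandZero_projChart_of_forall_ne (s : Idx N → ℂ) {f : T N → Option (ZMod p)}
    {y : T N → ℤ_[p]} (hy : ∀ i, f i = none → y i ≠ 0) :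
    ((∏ i, projDensity (f i) (y i) : ℝ≥0) : ℂ) * integrandZero s (fun i => projChart (f i) (y i)) =
      (∏ i, (p : ℂ)⁻¹ *
        if Marked (f i) then cpw ((p : ℝ)⁻¹ * ‖y i‖) (markWeight (f i) s i) else 1) *
      ∏ q : Pairs N, if f q.1.1 = f q.1.2 then
        cpw ((p : ℝ)⁻¹ * ‖y q.1.1 - y q.1.2‖) (cPair s q) else 1 := by
  have hheight (i) : chartHeight (f i) (y i) ≠ 0 := chartHeight_ne_zero (hy i)
  have hpair (q : Pairs N) :
      cpw ‖projChart (f q.1.1) (y q.1.1) - projChart (f q.1.2) (y q.1.2)‖ (cPair s q) =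
        (if f q.1.1 = f q.1.2 then cpw ((p : ℝ)⁻¹ * ‖y q.1.1 - y q.1.2‖) (cPair s q) else 1) *
        (cpw (chartHeight (f q.1.1) (y q.1.1)) (cPair s q) *
          cpw (chartHeight (f q.1.2) (y q.1.2)) (cPair s q)) := by
    rw [norm_projChart_sub_projChart (hy _) (hy _), cpw_mul (by positivity)
      (mul_nonneg (chartHeight_nonneg _ _) (chartHeight_nonneg _ _)),
      cpw_mul (chartHeight_nonneg _ _) (chartHeight_nonneg _ _), apply_ite (cpw · _), cpw_one]
  simp only [integrandZero, hpair, ← projDensity_mul_factor s _ (hy _), Finset.prod_mul_distrib]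
  rw [prod_cpw_fiberwise hheight (fun q : Pairs N => q.1.1),
    prod_cpw_fiberwise hheight (fun q : Pairs N => q.1.2)]
  push_cast
  ring

/-- The contribution of the residue class `a` to the integrand in the charts `f`. -/
def classFactor (s : Idx N → ℂ) (f : T N → Option (ZMod p)) (a : Option (ZMod p))
    (y : T N → ℤ_[p]) : ℂ :=
  (p : ℂ)⁻¹ ^ (ordinary (classSet f a)).card *
    ((p : ℂ) ^ (-weightSum (classWeight a s) (classSet f a)) *
      cluster (classWeight a s) (classSet f a) y)

theorem classFactor_eq (s : Idx N → ℂ) (f : T N → Option (ZMod p)) (a : Option (ZMod p))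
    (y : T N → ℤ_[p]) :
    classFactor s f a y =
      (∏ i with f i = a, (p : ℂ)⁻¹ *
        if Marked (f i) then cpw ((p : ℝ)⁻¹ * ‖y i‖) (markWeight (f i) s i) else 1) *
      ∏ q : Pairs N with f q.1.1 = a ∧ f q.1.2 = a,
        cpw ((p : ℝ)⁻¹ * ‖y q.1.1 - y q.1.2‖) (cPair s q) := by
  rw [classFactor, cpow_neg_weightSum_mul_cluster, prod_pairsIn, ← mul_assoc]
  have hord (i : T N) : i ∈ ordinary (classSet f a) ↔ f i = a := by simp [ordinary_classSet]
  simp only [hord, bot_mem_classSet, classWeight_bot, classWeight_coe_coe]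
  refine congrArg₂ (· * ·) ?_ rfl
  rw [ordinary_classSet, Finset.prod_mul_distrib, Finset.prod_const]
  refine congrArg₂ (· * ·) rfl ?_
  have hmark : ∀ i ∈ Finset.univ.filter fun i => f i = a,
      (if Marked (f i) then cpw ((p : ℝ)⁻¹ * ‖y i‖) (markWeight (f i) s i) else 1) =
        if Marked a then cpw ((p : ℝ)⁻¹ * ‖y i‖) (markWeight a s i) else 1 :=
    fun i hi => by rw [(Finset.mem_filter.1 hi).2]
  rw [Finset.prod_congr rfl hmark]
  split_ifs
  · simp [extendZero]
  · simp

theorem classFactor_none_eq_zero (s : Idx N → ℂ) {f : T N → Option (ZMod p)} {y : T N → ℤ_[p]}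
    {i : T N} (hi : f i = none) (hyi : y i = 0) : classFactor s f none y = 0 := by
  have hmem : ((⊥ : WithBot (T N)), (i : WithBot (T N))) ∈ pairsIn (classSet f none) :=
    mem_pairsIn.2 ⟨⟨bot_mem_classSet.2 (Or.inl rfl), coe_mem_classSet.2 hi⟩, WithBot.bot_lt_coe i⟩
  have hzero : ‖extendZero y ⊥ - extendZero y (i : WithBot (T N))‖ = 0 := by
    simp [extendZero, hyi]
  rw [classFactor, cluster, Finset.prod_eq_zero hmem (by rw [hzero, cpw_zero]), mul_zero, mul_zero]

/-- The residue classes separate because points in distinct ones are at chordal distance `1`. -/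
theorem integrandZero_projChart (s : Idx N → ℂ) (f : T N → Option (ZMod p)) (y : T N → ℤ_[p]) :
    ((∏ i, projDensity (f i) (y i) : ℝ≥0) : ℂ) * integrandZero s (fun i => projChart (f i) (y i)) =
      ∏ a, classFactor s f a y := by
  by_cases hy : ∀ i, f i = none → y i ≠ 0
  · rw [integrandZero_projChart_of_forall_ne s hy]
    simp only [classFactor_eq, Finset.prod_mul_distrib (s := Finset.univ), Finset.prod_fiberwise]
    congr 1
    simp only [Finset.prod_filter]
    rw [Finset.prod_comm]
    refine Finset.prod_congr rfl fun q _ => ?_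
    simp [ite_and, eq_comm]
  · push Not at hy
    obtain ⟨i, hi, hyi⟩ := hy
    have hdensity : ∏ i, projDensity (f i) (y i) = 0 :=
      Finset.prod_eq_zero (Finset.mem_univ i) (by simp [hi, projDensity, hyi])
    rw [hdensity, Finset.prod_eq_zero (Finset.mem_univ none) (classFactor_none_eq_zero s hi hyi),
      NNReal.coe_zero, Complex.ofReal_zero, zero_mul]

end ProjectiveCharts

/-! ### The exponents of the clusters -/

section BoundaryForms

variable {N : ℕ}

/-- An affine form `d + ∑_{k ∈ A} s_k` with `d ∈ ℕ`. The conditions that define `regionH N` are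
sign conditions on forms of this shape. -/
structure AffForm (N : ℕ) where
  /-- The constant term `d`. -/
  const : ℕ
  /-- The set `A` of the variables that occur. -/
  support : Finset (Idx N)

/-- The value of an affine form. -/
def AffForm.eval {R : Type} [Semiring R] (L : AffForm N) (s : Idx N → R) : R :=
  L.const + ∑ k ∈ L.support, s k

theorem AffForm.re_eval (L : AffForm N) (s : Idx N → ℂ) : (L.eval s).re = L.eval (rePart s) := by
  simp [AffForm.eval, rePart]

/-- The set of indices consisting of the `1i`, `(N-1)j` and `q` with `i ∈ A`, `j ∈ B`, `q ∈ C`. -/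
def idxSet (A B : Finset (T N)) (C : Finset (Pairs N)) : Finset (Idx N) :=
  A.disjSum (B.disjSum C)

theorem sum_idxSet {R : Type} [AddCommMonoid R] (A B : Finset (T N)) (C : Finset (Pairs N))
    (s : Idx N → R) :
    ∑ k ∈ idxSet A B C, s k = ∑ i ∈ A, c1 s i + (∑ i ∈ B, cLast s i + ∑ q ∈ C, cPair s q) := by
  simp only [idxSet, Finset.sum_disjSum]
  rfl

/-- The pairs of elements of `J`. -/
def pairsWithin (J : Finset (T N)) : Finset (Pairs N) := {q | q.1.1 ∈ J ∧ q.1.2 ∈ J}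

/-- The pairs with at least one element in `J`. -/
def pairsTouching (J : Finset (T N)) : Finset (Pairs N) := {q | q.1.1 ∈ J ∨ q.1.2 ∈ J}

/-- The affine form `formDiag K`; for empty `K` the constant term is truncated to `0`. -/
def diagForm (K : Finset (T N)) : AffForm N := ⟨K.card - 1, idxSet ∅ ∅ (pairsWithin K)⟩

/-- The affine form `formZero J`. -/
def zeroForm (J : Finset (T N)) : AffForm N := ⟨J.card, idxSet J ∅ (pairsWithin J)⟩

/-- The affine form `formOne J`. -/
def oneForm (J : Finset (T N)) : AffForm N := ⟨J.card, idxSet ∅ J (pairsWithin J)⟩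

/-- The affine form `formInfty J`. -/
def inftyForm (J : Finset (T N)) : AffForm N := ⟨J.card, idxSet J J (pairsTouching J)⟩

theorem eval_diagForm {K : Finset (T N)} (hK : K.Nonempty) (σ : Idx N → ℝ) :
    (diagForm K).eval σ = formDiag K σ := by
  simp [AffForm.eval, diagForm, sum_idxSet, formDiag, pairsWithin, Nat.cast_sub hK.card_pos]

theorem eval_zeroForm (J : Finset (T N)) (σ : Idx N → ℝ) :
    (zeroForm J).eval σ = formZero J σ := by
  simp [AffForm.eval, zeroForm, sum_idxSet, formZero, pairsWithin, add_assoc]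

theorem eval_oneForm (J : Finset (T N)) (σ : Idx N → ℝ) : (oneForm J).eval σ = formOne J σ := by
  simp [AffForm.eval, oneForm, sum_idxSet, formOne, pairsWithin, add_assoc]

theorem eval_inftyForm (J : Finset (T N)) (σ : Idx N → ℝ) :
    (inftyForm J).eval σ = formInfty J σ := by
  have hsplit : ∑ q ∈ pairsTouching J, cPair σ q = (∑ q : Pairs N with q.1.1 ∈ J, cPair σ q) +
      ∑ q : Pairs N with q.1.1 ∉ J ∧ q.1.2 ∈ J, cPair σ q := by
    simp only [pairsTouching, Finset.sum_filter, ← Finset.sum_add_distrib]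
    refine Finset.sum_congr rfl fun q _ => ?_
    by_cases hq : q.1.1 ∈ J <;> simp [hq]
  simp only [AffForm.eval, inftyForm, sum_idxSet, formInfty, hsplit, Finset.sum_add_distrib]
  ring

theorem notMem_polarHyperplanes {s : Idx N → ℂ} (hs : s ∈ regionH N) :
    rePart s ∉ polarHyperplanes N := by
  obtain ⟨hinfty, hdiag, hzero, hone⟩ := hs
  rintro (⟨J, hJ, h⟩ | ⟨K, hK, h⟩ | ⟨J, hJ, h⟩ | ⟨J, hJ, h⟩)
  · exact (hinfty J hJ).ne h
  · exact (hdiag K hK).ne' h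
  · exact (hzero J hJ).ne' h
  · exact (hone J hJ).ne' h

end BoundaryForms

section Exponents

variable {p N : ℕ}

theorem ordinary_nonempty {τ : Type*} {I : Finset (WithBot τ)} (hI : 2 ≤ I.card) :
    (ordinary I).Nonempty := by
  classical
  have h := card_eq_card_ordinary_add I
  refine Finset.card_pos.1 ?_
  split_ifs at h <;> omega

theorem weightSum_classWeight (a : Option (ZMod p)) (I : Finset (WithBot (T N)))
    (s : Idx N → ℂ) :
    weightSum (classWeight a s) I = (if ⊥ ∈ I then ∑ i ∈ ordinary I, markWeight a s i else 0) +
      ∑ q ∈ pairsWithin (ordinary I), cPair s q := by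
  rw [weightSum, sum_pairsIn]
  simp only [classWeight_bot, classWeight_coe_coe]
  rfl

theorem eval_diagForm_ordinary (a : Option (ZMod p)) {I : Finset (WithBot (T N))} (hb : ⊥ ∉ I)
    (hI : I.Nonempty) (s : Idx N → ℂ) :
    (I.card : ℂ) - 1 + weightSum (classWeight a s) I = (diagForm (ordinary I)).eval s := by
  have hc := card_eq_card_ordinary_add I
  rw [if_neg hb, add_zero] at hc
  rw [weightSum_classWeight, if_neg hb, AffForm.eval, diagForm, sum_idxSet, ← hc,
    Nat.cast_sub hI.card_pos]
  simp

theorem card_sub_one_add_weightSum_of_bot_mem (a : Option (ZMod p)) {I : Finset (WithBot (T N))}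
    (hb : ⊥ ∈ I) (s : Idx N → ℂ) :
    (I.card : ℂ) - 1 + weightSum (classWeight a s) I = (ordinary I).card +
      (∑ i ∈ ordinary I, markWeight a s i + ∑ q ∈ pairsWithin (ordinary I), cPair s q) := by
  rw [weightSum_classWeight, if_pos hb, card_eq_card_ordinary_add, if_pos hb]
  push_cast
  ring

theorem sum_markWeight_none (J : Finset (T N)) (s : Idx N → ℂ) :
    (J.card : ℂ) + (∑ i ∈ J, markWeight (none : Option (ZMod p)) s i +
      ∑ q ∈ pairsWithin J, cPair s q) = -(inftyForm J).eval s := by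
  have hfiber (π : Pairs N → T N) : ∑ i ∈ J, ∑ q : Pairs N with π q = i, cPair s q =
      ∑ q : Pairs N with π q ∈ J, cPair s q :=
    Finset.sum_fiberwise_eq_sum_filter Finset.univ J π (cPair s)
  have hor : ∑ q ∈ pairsTouching J, cPair s q + ∑ q ∈ pairsWithin J, cPair s q =
      (∑ q : Pairs N with q.1.1 ∈ J, cPair s q) + ∑ q : Pairs N with q.1.2 ∈ J, cPair s q := by
    rw [pairsTouching, pairsWithin, Finset.filter_or, Finset.filter_and, Finset.sum_union_inter]
  simp only [AffForm.eval, inftyForm, sum_idxSet, markWeight, Finset.sum_neg_distrib,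
    Finset.sum_add_distrib, hfiber, Finset.sum_const, nsmul_eq_mul]
  linear_combination hor

theorem exponent_cases (a : Option (ZMod p)) {I : Finset (WithBot (T N))} (hI : 2 ≤ I.card) :
    (∃ K : Finset (T N), 2 ≤ K.card ∧
      ∀ s, (I.card : ℂ) - 1 + weightSum (classWeight a s) I = (diagForm K).eval s) ∨
    (∃ J : Finset (T N), J.Nonempty ∧
      ∀ s, (I.card : ℂ) - 1 + weightSum (classWeight a s) I = (zeroForm J).eval s) ∨
    (∃ J : Finset (T N), J.Nonempty ∧
      ∀ s, (I.card : ℂ) - 1 + weightSum (classWeight a s) I = (oneForm J).eval s) ∨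
    ∃ J : Finset (T N), J.Nonempty ∧
      ∀ s, (I.card : ℂ) - 1 + weightSum (classWeight a s) I = -(inftyForm J).eval s := by
  by_cases hb : ⊥ ∈ I
  · have hJ := ordinary_nonempty hI
    simp only [card_sub_one_add_weightSum_of_bot_mem a hb]
    right
    rcases a with _ | a
    · exact Or.inr (Or.inr ⟨_, hJ, sum_markWeight_none _⟩)
    · by_cases ha : a = 0
      · exact Or.inl ⟨_, hJ, fun s => by
          simp [ha, markWeight, AffForm.eval, zeroForm, sum_idxSet]⟩
      · exact Or.inr (Or.inl ⟨_, hJ, fun s => by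
          simp [ha, markWeight, AffForm.eval, oneForm, sum_idxSet]⟩)
  · have hc := card_eq_card_ordinary_add I
    rw [if_neg hb, add_zero] at hc
    exact Or.inl ⟨_, hc ▸ hI, eval_diagForm_ordinary a hb (Finset.card_pos.1 (by omega))⟩

theorem exists_affForm (a : Option (ZMod p)) {I : Finset (WithBot (T N))} (hI : 2 ≤ I.card) :
    ∃ L : AffForm N, (∀ σ, L.eval σ = 0 → σ ∈ polarHyperplanes N) ∧
      ((∀ s, (I.card : ℂ) - 1 + weightSum (classWeight a s) I = L.eval s) ∨
        ∀ s, (I.card : ℂ) - 1 + weightSum (classWeight a s) I = -L.eval s) := by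
  rcases exponent_cases a hI with ⟨K, hK, h⟩ | ⟨J, hJ, h⟩ | ⟨J, hJ, h⟩ | ⟨J, hJ, h⟩
  · refine ⟨diagForm K, fun σ hσ => Or.inr (Or.inl ⟨K, hK, ?_⟩), Or.inl h⟩
    rwa [eval_diagForm (Finset.card_pos.1 (by omega))] at hσ
  · exact ⟨zeroForm J,
      fun σ hσ => Or.inr (Or.inr (Or.inl ⟨J, hJ, eval_zeroForm J σ ▸ hσ⟩)), Or.inl h⟩
  · exact ⟨oneForm J,
      fun σ hσ => Or.inr (Or.inr (Or.inr ⟨J, hJ, eval_oneForm J σ ▸ hσ⟩)), Or.inl h⟩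
  · exact ⟨inftyForm J, fun σ hσ => Or.inl ⟨J, hJ, eval_inftyForm J σ ▸ hσ⟩, Or.inr h⟩

theorem isConvergent_classWeight {s : Idx N → ℂ} (hs : s ∈ regionH N) (a : Option (ZMod p)) :
    IsConvergent (classWeight a s) := by
  obtain ⟨hinfty, hdiag, hzero, hone⟩ := hs
  intro I hI
  have hre : (I.card : ℝ) - 1 + (weightSum (classWeight a s) I).re =
      ((I.card : ℂ) - 1 + weightSum (classWeight a s) I).re := by simp
  rw [hre]
  rcases exponent_cases a hI with ⟨K, hK, h⟩ | ⟨J, hJ, h⟩ | ⟨J, hJ, h⟩ | ⟨J, hJ, h⟩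
  · rw [h, AffForm.re_eval, eval_diagForm (Finset.card_pos.1 (by omega))]
    exact hdiag K hK
  · rw [h, AffForm.re_eval, eval_zeroForm]
    exact hzero J hJ
  · rw [h, AffForm.re_eval, eval_oneForm]
    exact hone J hJ
  · rw [h, Complex.neg_re, AffForm.re_eval, eval_inftyForm]
    exact neg_pos.2 (hinfty J hJ)

end Exponents

section RationalFunctions

variable {p N : ℕ}

variable (p N) in
/-- The polynomials that are admitted as denominators of the continuation: their zeros lie over the
polar hyperplanes. -/
def denominators : Submonoid (MvPolynomial (Idx N) ℂ) where
  carrier := {Q | ∀ s, rePart s ∉ polarHyperplanes N → evalAt p Q s ≠ 0}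
  one_mem' s _ := by simp [evalAt]
  mul_mem' hP hQ s hs := by
    rw [evalAt, map_mul]
    exact mul_ne_zero (hP s hs) (hQ s hs)

theorem evalAt_ne_zero_of_mem_regionH {Q : MvPolynomial (Idx N) ℂ} (hQ : Q ∈ denominators p N)
    {s : Idx N → ℂ} (hs : s ∈ regionH N) : evalAt p Q s ≠ 0 :=
  hQ s (notMem_polarHyperplanes hs)

variable (p N) in
/-- The functions on the region of convergence that are rational functions of the `p ^ (-s_{ij})`
with an admissible denominator. -/
def rationalFunctions : Subring (regionH N → ℂ) where
  carrier := {g | ∃ P : MvPolynomial (Idx N) ℂ, ∃ Q ∈ denominators p N,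
    ∀ s : regionH N, g s = evalAt p P s / evalAt p Q s}
  zero_mem' := ⟨0, 1, one_mem _, fun s => by simp [evalAt]⟩
  one_mem' := ⟨1, 1, one_mem _, fun s => by simp [evalAt]⟩
  add_mem' := by
    rintro g h ⟨P, Q, hQ, hg⟩ ⟨P', Q', hQ', hh⟩
    refine ⟨P * Q' + Q * P', Q * Q', mul_mem hQ hQ', fun s => ?_⟩
    rw [Pi.add_apply, hg, hh, div_add_div _ _ (evalAt_ne_zero_of_mem_regionH hQ s.2)
      (evalAt_ne_zero_of_mem_regionH hQ' s.2)]
    simp only [evalAt, map_add, map_mul]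
  mul_mem' := by
    rintro g h ⟨P, Q, hQ, hg⟩ ⟨P', Q', hQ', hh⟩
    refine ⟨P * P', Q * Q', mul_mem hQ hQ', fun s => ?_⟩
    rw [Pi.mul_apply, hg, hh, div_mul_div_comm]
    simp only [evalAt, map_mul]
  neg_mem' := by
    rintro g ⟨P, Q, hQ, hg⟩
    refine ⟨-P, Q, hQ, fun s => ?_⟩
    rw [Pi.neg_apply, hg, ← neg_div]
    simp only [evalAt, map_neg]

theorem const_mem_rationalFunctions (c : ℂ) :
    (fun _ => c) ∈ rationalFunctions p N :=
  ⟨MvPolynomial.C c, 1, one_mem _, fun s => by simp [evalAt]⟩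

theorem inv_evalAt_mem_rationalFunctions {Q : MvPolynomial (Idx N) ℂ}
    (hQ : Q ∈ denominators p N) :
    (fun s : regionH N => (evalAt p Q s)⁻¹) ∈ rationalFunctions p N :=
  ⟨1, Q, hQ, fun s => by simp [evalAt, one_div]⟩

variable (p) in
/-- The monomial with value `p ^ (-L s)` at `(p ^ (-s_{ij}))`. -/
def AffForm.monomial (L : AffForm N) : MvPolynomial (Idx N) ℂ :=
  MvPolynomial.C ((p : ℂ)⁻¹ ^ L.const) * ∏ k ∈ L.support, MvPolynomial.X k

variable [hp : Fact p.Prime]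

theorem evalAt_monomial (L : AffForm N) (s : Idx N → ℂ) :
    evalAt p (L.monomial p) s = (p : ℂ) ^ (-L.eval s) := by
  have hp0 : (p : ℂ) ≠ 0 := by exact_mod_cast hp.out.ne_zero
  rw [AffForm.eval, neg_add, Complex.cpow_add _ _ hp0, Complex.cpow_neg, Complex.cpow_natCast]
  simp only [evalAt, AffForm.monomial, map_mul, map_prod, MvPolynomial.eval_C,
    MvPolynomial.eval_X, inv_pow, Complex.cpow_def_of_ne_zero hp0, ← Complex.exp_sum,
    ← Finset.mul_sum, Finset.sum_neg_distrib]

theorem monomial_mem_denominators (L : AffForm N) : L.monomial p ∈ denominators p N := by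
  intro s _
  have hp0 : (p : ℂ) ≠ 0 := by exact_mod_cast hp.out.ne_zero
  rw [evalAt_monomial]
  exact Complex.cpow_ne_zero_iff.2 (Or.inl hp0)

theorem cpow_ne_one_of_re_ne_zero {z : ℂ} (hz : z.re ≠ 0) : (p : ℂ) ^ z ≠ 1 := by
  intro h
  have hp1 : (1 : ℝ) < p := by exact_mod_cast hp.out.one_lt
  have hnorm := congrArg norm h
  rw [Complex.norm_natCast_cpow_of_pos hp.out.pos, norm_one] at hnorm
  rcases hz.lt_or_gt with hneg | hpos
  · exact (Real.rpow_lt_one_of_one_lt_of_neg hp1 hneg).ne hnorm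
  · exact (Real.one_lt_rpow hp1 hpos).ne' hnorm

theorem one_sub_monomial_mem_denominators {L : AffForm N}
    (hL : ∀ σ, L.eval σ = 0 → σ ∈ polarHyperplanes N) : 1 - L.monomial p ∈ denominators p N := by
  intro s hs
  have heval : evalAt p (1 - L.monomial p) s = 1 - (p : ℂ) ^ (-L.eval s) := by
    rw [← evalAt_monomial]
    simp only [evalAt, map_sub, map_one]
  rw [heval, sub_ne_zero]
  refine (cpow_ne_one_of_re_ne_zero ?_).symm
  rw [Complex.neg_re, neg_ne_zero, AffForm.re_eval]
  exact fun h => hs (hL _ h)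

theorem cpow_neg_eval_mem_rationalFunctions (L : AffForm N) :
    (fun s : regionH N => (p : ℂ) ^ (-L.eval s.1)) ∈ rationalFunctions p N :=
  ⟨L.monomial p, 1, one_mem _, fun s => by rw [evalAt_monomial]; simp [evalAt]⟩

theorem cpow_eval_mem_rationalFunctions (L : AffForm N) :
    (fun s : regionH N => (p : ℂ) ^ L.eval s.1) ∈ rationalFunctions p N := by
  simpa only [evalAt_monomial, Complex.cpow_neg, inv_inv] using
    inv_evalAt_mem_rationalFunctions (monomial_mem_denominators (p := p) L)

theorem inv_one_sub_cpow_neg_eval_mem_rationalFunctions {L : AffForm N}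
    (hL : ∀ σ, L.eval σ = 0 → σ ∈ polarHyperplanes N) :
    (fun s : regionH N => (1 - (p : ℂ) ^ (-L.eval s.1))⁻¹) ∈ rationalFunctions p N := by
  have hinv := inv_evalAt_mem_rationalFunctions (one_sub_monomial_mem_denominators (p := p) hL)
  simpa only [← evalAt_monomial, evalAt, map_sub, map_one] using hinv

theorem inv_one_sub_cpow_eval_mem_rationalFunctions {L : AffForm N}
    (hL : ∀ σ, L.eval σ = 0 → σ ∈ polarHyperplanes N) :
    (fun s : regionH N => (1 - (p : ℂ) ^ L.eval s.1)⁻¹) ∈ rationalFunctions p N := by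
  have hp0 : (p : ℂ) ≠ 0 := by exact_mod_cast hp.out.ne_zero
  refine cast (congrArg (· ∈ rationalFunctions p N) (funext fun s => ?_))
    (neg_mem (mul_mem (cpow_neg_eval_mem_rationalFunctions (p := p) L)
      (inv_one_sub_cpow_neg_eval_mem_rationalFunctions hL)))
  have hz : (p : ℂ) ^ L.eval s.1 ≠ 0 := Complex.cpow_ne_zero_iff.2 (Or.inl hp0)
  rw [Pi.neg_apply, Pi.mul_apply, Complex.cpow_neg, ← mul_inv, mul_sub, mul_one,
    mul_inv_cancel₀ hz, ← inv_neg, neg_sub]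

theorem ratio_mem_rationalFunctions (a : Option (ZMod p)) {I : Finset (WithBot (T N))}
    (hI : 2 ≤ I.card) :
    (fun s : regionH N => ratio p (classWeight a s.1) I) ∈ rationalFunctions p N := by
  obtain ⟨L, -, h | h⟩ := exists_affForm a hI
  · simpa only [ratio, h] using cpow_neg_eval_mem_rationalFunctions L
  · simpa only [ratio, h, neg_neg] using cpow_eval_mem_rationalFunctions L

theorem inv_one_sub_ratio_mem_rationalFunctions (a : Option (ZMod p))
    {I : Finset (WithBot (T N))} (hI : 2 ≤ I.card) :
    (fun s : regionH N => (1 - ratio p (classWeight a s.1) I)⁻¹) ∈ rationalFunctions p N := by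
  obtain ⟨L, hL, h | h⟩ := exists_affForm a hI
  · simpa only [ratio, h] using inv_one_sub_cpow_neg_eval_mem_rationalFunctions hL
  · simpa only [ratio, h, neg_neg] using inv_one_sub_cpow_eval_mem_rationalFunctions hL

theorem cpow_neg_weightSum_mem_rationalFunctions (a : Option (ZMod p))
    (I : Finset (WithBot (T N))) :
    (fun s : regionH N => (p : ℂ) ^ (-weightSum (classWeight a s.1) I)) ∈
      rationalFunctions p N := by
  have hp0 : (p : ℂ) ≠ 0 := by exact_mod_cast hp.out.ne_zero
  rcases Nat.lt_or_ge I.card 2 with hI | hI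
  · simpa [weightSum_of_card_le_one _ (Nat.le_of_lt_succ hI)] using
      const_mem_rationalFunctions (p := p) (N := N) 1
  · refine cast (congrArg (· ∈ rationalFunctions p N) (funext fun s => ?_))
      (mul_mem (const_mem_rationalFunctions ((p : ℂ) ^ ((I.card : ℂ) - 1)))
        (ratio_mem_rationalFunctions a hI))
    rw [Pi.mul_apply, ratio, ← Complex.cpow_add _ _ hp0]
    congr 1
    ring

theorem clusterIntegral_mem_rationalFunctions (a : Option (ZMod p)) (I : Finset (WithBot (T N))) :
    (fun s : regionH N => clusterIntegral p (classWeight a s.1) I) ∈ rationalFunctions p N :=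
  clusterIntegral_mem _ (fun s => isConvergent_classWeight s.2 a) (const_mem_rationalFunctions _)
    (cpow_neg_weightSum_mem_rationalFunctions a)
    (fun _ => inv_one_sub_ratio_mem_rationalFunctions a) I

end RationalFunctions

section Zeta

variable {p : ℕ} [hp : Fact p.Prime] {N : ℕ}

theorem measurable_classFactor (s : Idx N → ℂ) (f : T N → Option (ZMod p)) (a : Option (ZMod p)) :
    Measurable (classFactor s f a) :=
  ((measurable_cluster _ _).const_mul _).const_mul _

theorem dependsOn_classFactor (s : Idx N → ℂ) (f : T N → Option (ZMod p)) (a : Option (ZMod p)) :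
    DependsOn (classFactor s f a) (ordinary (classSet f a) : Set (T N)) := by
  intro y y' h
  simp only [classFactor, dependsOn_cluster _ _ h]

theorem integrable_classFactor {s : Idx N → ℂ} (hs : s ∈ regionH N) (f : T N → Option (ZMod p))
    (a : Option (ZMod p)) : Integrable (classFactor s f a) (haarPi p (T N)) :=
  ((integrable_cluster (isConvergent_classWeight hs a) _).const_mul _).const_mul _

theorem integral_classFactor (s : Idx N → ℂ) (f : T N → Option (ZMod p)) (a : Option (ZMod p)) :
    ∫ y, classFactor s f a y ∂haarPi p (T N) = (p : ℂ)⁻¹ ^ (ordinary (classSet f a)).card *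
      ((p : ℂ) ^ (-weightSum (classWeight a s) (classSet f a)) *
        clusterIntegral p (classWeight a s) (classSet f a)) := by
  simp only [classFactor, integral_const_mul, clusterIntegral]

theorem smul_integrandZero_projChart (s : Idx N → ℂ) (f : T N → Option (ZMod p)) :
    (fun y : T N → ℤ_[p] => (∏ i, projDensity (f i) (y i)) •
      integrandZero s fun i => projChart (f i) (y i)) = fun y => ∏ a, classFactor s f a y := by
  funext y
  rw [NNReal.smul_def, Complex.real_smul, integrandZero_projChart]

theorem integrable_smul_integrandZero_projChart {s : Idx N → ℂ} (hs : s ∈ regionH N)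
    (f : T N → Option (ZMod p)) :
    Integrable (fun y : T N → ℤ_[p] => (∏ i, projDensity (f i) (y i)) •
      integrandZero s fun i => projChart (f i) (y i)) (haarPi p (T N)) := by
  rw [smul_integrandZero_projChart]
  exact integrable_pi_prod_of_dependsOn (disjoint_ordinary_classSet f)
    (measurable_classFactor s f) (dependsOn_classFactor s f) (integrable_classFactor hs f)

theorem integrable_integrandZero {s : Idx N → ℂ} (hs : s ∈ regionH N) :
    Integrable (integrandZero s) (haarN p N) :=
  (integrable_pi_iff_forall_chart measurable_projChart measurable_projDensity
    haarQp_eq_sum_map_projChart (measurable_integrandZero s).stronglyMeasurable).2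
    (integrable_smul_integrandZero_projChart hs)

theorem integral_integrandZero {s : Idx N → ℂ} (hs : s ∈ regionH N) :
    ∫ x, integrandZero s x ∂haarN p N = ∑ f : T N → Option (ZMod p), ∏ a,
      (p : ℂ)⁻¹ ^ (ordinary (classSet f a)).card *
        ((p : ℂ) ^ (-weightSum (classWeight a s) (classSet f a)) *
          clusterIntegral p (classWeight a s) (classSet f a)) := by
  rw [haarN, integral_pi_eq_sum_chart measurable_projChart measurable_projDensity
    haarQp_eq_sum_map_projChart (measurable_integrandZero s).stronglyMeasurable
    (integrable_smul_integrandZero_projChart hs)]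
  refine Finset.sum_congr rfl fun f _ => ?_
  rw [smul_integrandZero_projChart, integral_pi_prod_of_dependsOn (disjoint_ordinary_classSet f)
    (measurable_classFactor s f) (dependsOn_classFactor s f)]
  exact Finset.prod_congr rfl fun a _ => integral_classFactor s f a

theorem integrableOn_integrand {s : Idx N → ℂ} (hs : s ∈ regionH N) :
    IntegrableOn (integrand p s) (Lam p N)ᶜ (haarN p N) := by
  rw [← integrable_indicator_iff measurableSet_Lam.compl, indicator_integrand]
  exact integrable_integrandZero hs

theorem zeta_eq_integral_integrandZero (s : Idx N → ℂ) :
    zeta p N s = ∫ x, integrandZero s x ∂haarN p N := by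
  rw [zeta, ← integral_indicator measurableSet_Lam.compl, indicator_integrand]

theorem zeta_mem_rationalFunctions :
    (fun s : regionH N => zeta p N s) ∈ rationalFunctions p N := by
  have hzeta : (fun s : regionH N => zeta p N s) = ∑ f : T N → Option (ZMod p), ∏ a,
      (fun _ => (p : ℂ)⁻¹ ^ (ordinary (classSet f a)).card) *
        ((fun s : regionH N => (p : ℂ) ^ (-weightSum (classWeight a s.1) (classSet f a))) *
          fun s : regionH N => clusterIntegral p (classWeight a s.1) (classSet f a)) := by
    funext s
    rw [zeta_eq_integral_integrandZero, integral_integrandZero s.2]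
    simp only [Finset.sum_apply, Finset.prod_apply, Pi.mul_apply]
  rw [hzeta]
  exact sum_mem fun f _ => prod_mem fun a _ => mul_mem (const_mem_rationalFunctions _) <|
    mul_mem (cpow_neg_weightSum_mem_rationalFunctions a _)
      (clusterIntegral_mem_rationalFunctions a _)

end Zeta

/-! ### The region of convergence -/

section Region

variable {N : ℕ}

theorem continuous_rePart : Continuous (rePart : (Idx N → ℂ) → Idx N → ℝ) :=
  continuous_pi fun k => Complex.continuous_re.comp (continuous_apply k)

theorem continuous_formInfty (J : Finset (T N)) : Continuous (formInfty J) := by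
  unfold formInfty c1 cLast cPair
  fun_prop

theorem continuous_formDiag (K : Finset (T N)) : Continuous (formDiag K) := by
  unfold formDiag cPair
  fun_prop

theorem continuous_formZero (J : Finset (T N)) : Continuous (formZero J) := by
  unfold formZero c1 cPair
  fun_prop

theorem continuous_formOne (J : Finset (T N)) : Continuous (formOne J) := by
  unfold formOne cLast cPair
  fun_prop

theorem isOpen_regionH : IsOpen (regionH N) := by
  have hpos {P : Finset (T N) → Prop} {φ : Finset (T N) → (Idx N → ℝ) → ℝ}
      (hφ : ∀ J, Continuous (φ J)) : IsOpen {s : Idx N → ℂ | ∀ J, P J → 0 < φ J (rePart s)} := by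
    simp only [Set.ofPred_forall]
    exact isOpen_iInter_of_finite fun J => isOpen_iInter_of_finite fun _ =>
      isOpen_lt continuous_const ((hφ J).comp continuous_rePart)
  have hinfty := hpos (P := Finset.Nonempty) fun J => (continuous_formInfty J).neg
  simp only [Pi.neg_apply, neg_pos] at hinfty
  exact hinfty.and <| (hpos continuous_formDiag).and <|
    (hpos continuous_formZero).and (hpos continuous_formOne)

/-- The lower bounds of the real parts in the tube. -/
def tubeLower (N : ℕ) : Idx N → ℝ :=
  Sum.elim (fun _ => -2 / 3) (Sum.elim (fun _ => -2 / 3)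
    fun _ => -2 / (3 * (((N : ℝ) - 4) * ((N : ℝ) - 3) / 2)))

/-- The upper bounds of the real parts in the tube. -/
def tubeUpper (N : ℕ) : Idx N → ℝ :=
  Sum.elim (fun _ => -1 / 2) (Sum.elim (fun _ => -1 / 2) fun _ => 0)

theorem tube_eq_pi :
    tube N = Set.univ.pi fun k => Complex.re ⁻¹' Set.Ioo (tubeLower N k) (tubeUpper N k) := by
  ext s
  simp only [tube, Set.mem_ofPred_eq, Set.mem_pi, Set.mem_univ, true_imp_iff, Set.mem_preimage,
    Set.mem_Ioo, Sum.forall, tubeLower, tubeUpper, Sum.elim_inl, Sum.elim_inr, c1, cLast, cPair]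
  tauto

theorem card_subtype_lt (α : Type*) [LinearOrder α] [Fintype α] :
    Fintype.card {q : α × α // q.1 < q.2} = (Fintype.card α).choose 2 := by
  have hoff : ({q | q.1 < q.2} : Finset (α × α)) =
      {q ∈ (Finset.univ : Finset α).offDiag | q.1 < q.2} := by
    ext q
    simpa using ne_of_lt
  rw [← Sym2.card_subtype_not_diag, Fintype.card_subtype, Fintype.card_subtype, hoff,
    Finset.card_eq_sum_ones, Finset.card_eq_sum_ones, ← Finset.sym2_univ]
  exact (Finset.sum_sym2_filter_not_isDiag Finset.univ fun _ => 1).symm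

theorem card_pairs (hN : 4 ≤ N) :
    (Fintype.card (Pairs N) : ℝ) = ((N : ℝ) - 4) * ((N : ℝ) - 3) / 2 := by
  obtain ⟨m, rfl⟩ := Nat.exists_eq_add_of_le hN
  have hT : Fintype.card (T (4 + m)) = m + 1 := by
    rw [Fintype.card_coe, Nat.card_Icc]
    omega
  rw [card_subtype_lt, hT, Nat.cast_choose_two]
  push_cast
  ring

theorem isOpen_tube : IsOpen (tube N) := by
  rw [tube_eq_pi]
  exact isOpen_set_pi Set.finite_univ fun k _ => isOpen_Ioo.preimage Complex.continuous_re

theorem tubeLower_lt_tubeUpper (hN : 4 ≤ N) (k : Idx N) : tubeLower N k < tubeUpper N k := by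
  rcases k with i | i | q
  · norm_num [tubeLower, tubeUpper]
  · norm_num [tubeLower, tubeUpper]
  · have hcard : 0 < (Fintype.card (Pairs N) : ℝ) := by exact_mod_cast Fintype.card_pos_iff.2 ⟨q⟩
    simp only [tubeLower, tubeUpper, Sum.elim_inr, ← card_pairs hN]
    exact div_neg_of_neg_of_pos (by norm_num) (by positivity)

theorem isConnected_tube (hN : 4 ≤ N) : IsConnected (tube N) := by
  rw [tube_eq_pi]
  refine ⟨Set.univ_pi_nonempty_iff.2 fun k => ?_, isPreconnected_univ_pi fun k =>
    ((convex_Ioo _ _).linear_preimage Complex.reLm).isPreconnected⟩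
  exact (Set.nonempty_Ioo.2 (tubeLower_lt_tubeUpper hN k)).preimage Complex.re_surjective

theorem neg_two_thirds_lt_sum_cPair (hN : 4 ≤ N) {s : Idx N → ℂ} (hs : s ∈ tube N)
    (C : Finset (Pairs N)) : -2 / 3 < ∑ q ∈ C, cPair (rePart s) q := by
  rcases C.eq_empty_or_nonempty with rfl | hC
  · norm_num
  have hlower := hs.1
  rw [← card_pairs hN] at hlower
  have hcard : (C.card : ℝ) ≤ Fintype.card (Pairs N) := by exact_mod_cast C.card_le_univ
  have hpos : (0 : ℝ) < C.card := by exact_mod_cast hC.card_pos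
  calc (-2 / 3 : ℝ) ≤ ∑ _q ∈ C, -2 / (3 * (Fintype.card (Pairs N) : ℝ)) := by
        rw [Finset.sum_const, nsmul_eq_mul, mul_div_assoc',
          div_le_div_iff₀ (by norm_num) (by linarith)]
        linarith
    _ < ∑ q ∈ C, cPair (rePart s) q :=
        Finset.sum_lt_sum_of_nonempty hC fun q _ => (hlower q).1

theorem pairsWithin_eq_empty {J : Finset (T N)} (hJ : J.card ≤ 1) : pairsWithin J = ∅ :=
  Finset.filter_eq_empty_iff.2 fun q _ hq =>
    q.2.ne (Finset.card_le_one.1 hJ _ hq.1 _ hq.2)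

theorem card_add_sum_add_sum_cPair_pos (hN : 4 ≤ N) {s : Idx N → ℂ} (hs : s ∈ tube N)
    {σ : T N → ℝ} (hσ : ∀ i, -2 / 3 < σ i) {J : Finset (T N)} (hJ : J.Nonempty) :
    0 < (J.card : ℝ) + ∑ i ∈ J, σ i + ∑ q ∈ pairsWithin J, cPair (rePart s) q := by
  have hsum : ∑ _i ∈ J, (-2 / 3 : ℝ) < ∑ i ∈ J, σ i :=
    Finset.sum_lt_sum_of_nonempty hJ fun i _ => hσ i
  rw [Finset.sum_const, nsmul_eq_mul] at hsum
  rcases Nat.lt_or_ge J.card 2 with hcard | hcard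
  · have hone : (1 : ℝ) ≤ J.card := by exact_mod_cast hJ.card_pos
    rw [pairsWithin_eq_empty (by omega), Finset.sum_empty]
    linarith
  · have htwo : (2 : ℝ) ≤ J.card := by exact_mod_cast hcard
    linarith [neg_two_thirds_lt_sum_cPair hN hs (pairsWithin J)]

theorem formInfty_neg_of_mem_tube {s : Idx N → ℂ} (hs : s ∈ tube N) {J : Finset (T N)}
    (hJ : J.Nonempty) : formInfty J (rePart s) < 0 := by
  have hsum : ∑ i ∈ J, (c1 (rePart s) i + cLast (rePart s) i) < ∑ _i ∈ J, (-1 : ℝ) := by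
    refine Finset.sum_lt_sum_of_nonempty hJ fun i _ => ?_
    have hzero : c1 (rePart s) i < -1 / 2 := (hs.2.1 i).2
    have hone : cLast (rePart s) i < -1 / 2 := (hs.2.2 i).2
    linarith
  have hpairs (C : Finset (Pairs N)) : ∑ q ∈ C, cPair (rePart s) q ≤ 0 :=
    Finset.sum_nonpos fun q _ => (hs.1 q).2.le
  rw [Finset.sum_const, nsmul_eq_mul] at hsum
  unfold formInfty
  linarith [hpairs {q | q.1.1 ∈ J}, hpairs {q | q.1.1 ∉ J ∧ q.1.2 ∈ J}]

theorem formDiag_pos_of_mem_tube (hN : 4 ≤ N) {s : Idx N → ℂ} (hs : s ∈ tube N)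
    {K : Finset (T N)} (hK : 2 ≤ K.card) : 0 < formDiag K (rePart s) := by
  have htwo : (2 : ℝ) ≤ K.card := by exact_mod_cast hK
  unfold formDiag
  linarith [neg_two_thirds_lt_sum_cPair hN hs {q | q.1.1 ∈ K ∧ q.1.2 ∈ K}]

theorem tube_subset_regionH (hN : 4 ≤ N) : tube N ⊆ regionH N := fun _ hs =>
  ⟨fun _ hJ => formInfty_neg_of_mem_tube hs hJ, fun _ hK => formDiag_pos_of_mem_tube hN hs hK,
    fun _ hJ => card_add_sum_add_sum_cPair_pos hN hs (fun i => (hs.2.1 i).1) hJ,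
    fun _ hJ => card_add_sum_add_sum_cPair_pos hN hs (fun i => (hs.2.2 i).1) hJ⟩

end Region

/-! ### Divergence -/

section Divergence

variable {p : ℕ} [hp : Fact p.Prime] {N : ℕ}

theorem one_le_nnnorm_cpow {t : ℝ} (ht : 1 ≤ t) {z : ℂ} (hz : 0 ≤ z.re) :
    1 ≤ ‖(t : ℂ) ^ z‖₊ := by
  rw [← NNReal.coe_le_coe, coe_nnnorm, Complex.norm_cpow_eq_rpow_re_of_pos (by linarith)]
  exact Real.one_le_rpow ht hz

theorem one_le_enorm_integrand {s : Idx N → ℂ} (hs : ∀ k, 0 ≤ (s k).re) {x : T N → ℚ_[p]}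
    (hone : ∀ i, 1 < ‖x i‖) (hmono : StrictMono fun i => ‖x i‖) : 1 ≤ ‖integrand p s x‖ₑ := by
  rw [enorm_eq_nnnorm, ENNReal.one_le_coe_iff, integrand, nnnorm_mul, nnnorm_prod, nnnorm_prod]
  refine one_le_mul (Finset.one_le_prod' fun i _ => ?_) (Finset.one_le_prod' fun q _ => ?_)
  · rw [nnnorm_mul]
    refine one_le_mul (one_le_nnnorm_cpow (hone i).le (hs _)) (one_le_nnnorm_cpow ?_ (hs _))
    rw [norm_sub_rev, norm_sub_eq_left_of_norm_lt (by simpa using hone i)]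
    exact (hone i).le
  · refine one_le_nnnorm_cpow ?_ (hs _)
    rw [norm_sub_rev, norm_sub_eq_left_of_norm_lt (hmono q.2)]
    exact (hone _).le

theorem notMem_Lam {x : T N → ℚ_[p]} (hone : ∀ i, 1 < ‖x i‖)
    (hmono : StrictMono fun i => ‖x i‖) : x ∉ Lam p N := by
  rw [mem_Lam]
  rintro (⟨i, hi | hi⟩ | ⟨q, hq⟩)
  · exact absurd (hone i) (by simp [hi])
  · exact absurd (hone i) (by simp [← sub_eq_zero.1 hi])
  · exact (hmono q.2).ne (congrArg norm (sub_eq_zero.1 hq))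

theorem haarQp_compl_closedBall (r : ℝ) : haarQp p (Metric.closedBall 0 r)ᶜ = ∞ := by
  have huniv : haarQp p Set.univ = ∞ := measure_univ_of_isAddLeftInvariant _
  have hball : haarQp p (Metric.closedBall 0 r) ≠ ∞ :=
    (isCompact_closedBall 0 r).measure_lt_top.ne
  rw [measure_compl Metric.isClosed_closedBall.measurableSet hball, huniv, ENNReal.top_sub hball]

theorem haarQp_sphere_pow_ne_zero (n : ℕ) :
    haarQp p (Metric.sphere 0 ((p : ℝ) ^ n)) ≠ 0 := by
  have hp0 : (0 : ℝ) < p := by exact_mod_cast hp.out.pos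
  refine (IsUltrametricDist.isOpen_sphere (0 : ℚ_[p]) (by positivity)).measure_ne_zero _
    ⟨((p : ℚ_[p]) ^ n)⁻¹, ?_⟩
  simp

variable (p N) in
/-- A box of infinite volume on which the norms of the coordinates increase strictly: the `i`-th
factor is the sphere of radius `p ^ i`, except for the last one, which is unbounded. -/
def divergenceBox : Set (T N → ℚ_[p]) :=
  Set.univ.pi fun i => if (i : ℕ) = N - 2 then (Metric.closedBall 0 ((p : ℝ) ^ N))ᶜ else
    Metric.sphere 0 ((p : ℝ) ^ (i : ℕ))

theorem measurableSet_divergenceBox : MeasurableSet (divergenceBox p N) :=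
  MeasurableSet.univ_pi fun _ => by
    split_ifs
    · exact Metric.isClosed_closedBall.measurableSet.compl
    · exact Metric.isClosed_sphere.measurableSet

theorem haarN_divergenceBox (hN : 4 ≤ N) : haarN p N (divergenceBox p N) = ∞ := by
  rw [haarN, divergenceBox, Measure.pi_pi,
    ← Finset.mul_prod_erase _ _ (Finset.mem_univ ⟨N - 2, Finset.mem_Icc.2 ⟨by omega, le_rfl⟩⟩),
    if_pos rfl, haarQp_compl_closedBall, ENNReal.top_mul]
  refine Finset.prod_ne_zero_iff.2 fun i _ => ?_
  split_ifs
  · simp [haarQp_compl_closedBall]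
  · exact haarQp_sphere_pow_ne_zero i

theorem norm_mem_of_mem_divergenceBox {x : T N → ℚ_[p]} (hx : x ∈ divergenceBox p N) (i : T N) :
    (i : ℕ) = N - 2 ∧ (p : ℝ) ^ N < ‖x i‖ ∨ (i : ℕ) < N - 2 ∧ ‖x i‖ = (p : ℝ) ^ (i : ℕ) := by
  have hi := hx i (Set.mem_univ i)
  dsimp only at hi
  split_ifs at hi with hlast
  · exact .inl ⟨hlast, by simpa using hi⟩
  · exact .inr ⟨lt_of_le_of_ne (Finset.mem_Icc.1 i.2).2 hlast, by simpa using hi⟩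

theorem one_lt_norm_of_mem_divergenceBox {x : T N → ℚ_[p]} (hx : x ∈ divergenceBox p N)
    (i : T N) : 1 < ‖x i‖ := by
  have hp1 : (1 : ℝ) < p := by exact_mod_cast hp.out.one_lt
  have htwo : 2 ≤ (i : ℕ) := (Finset.mem_Icc.1 i.2).1
  rcases norm_mem_of_mem_divergenceBox hx i with ⟨hi, hxi⟩ | ⟨-, hxi⟩
  · exact (one_lt_pow₀ hp1 (by omega)).trans hxi
  · rw [hxi]
    exact one_lt_pow₀ hp1 (by omega)

theorem strictMono_norm_of_mem_divergenceBox {x : T N → ℚ_[p]} (hx : x ∈ divergenceBox p N) :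
    StrictMono fun i => ‖x i‖ := by
  intro i j hij
  have hp1 : (1 : ℝ) < p := by exact_mod_cast hp.out.one_lt
  have hlt : (i : ℕ) < j := hij
  have hj : (j : ℕ) ≤ N - 2 := (Finset.mem_Icc.1 j.2).2
  obtain ⟨hi, -⟩ | ⟨hi, hxi⟩ := norm_mem_of_mem_divergenceBox hx i
  · omega
  dsimp only
  rw [hxi]
  rcases norm_mem_of_mem_divergenceBox hx j with ⟨-, hxj⟩ | ⟨-, hxj⟩
  · exact (pow_lt_pow_right₀ hp1 (by omega)).trans hxj
  · rw [hxj]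
    exact pow_lt_pow_right₀ hp1 hlt

theorem lintegral_enorm_integrand_eq_top (hN : 4 ≤ N) {s : Idx N → ℂ} (hs : ∀ k, 0 ≤ (s k).re) :
    ∫⁻ x in (Lam p N)ᶜ, ‖integrand p s x‖ₑ ∂(haarN p N) = ∞ := by
  refine top_unique ?_
  calc ∞ = ∫⁻ _ in divergenceBox p N, 1 ∂(haarN p N) := by
        rw [setLIntegral_one, haarN_divergenceBox hN]
    _ ≤ ∫⁻ x in divergenceBox p N, ‖integrand p s x‖ₑ ∂(haarN p N) :=
        setLIntegral_mono' measurableSet_divergenceBox fun x hx =>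
          one_le_enorm_integrand hs (one_lt_norm_of_mem_divergenceBox hx)
            (strictMono_norm_of_mem_divergenceBox hx)
    _ ≤ ∫⁻ x in (Lam p N)ᶜ, ‖integrand p s x‖ₑ ∂(haarN p N) :=
        lintegral_mono_set fun x hx => notMem_Lam (one_lt_norm_of_mem_divergenceBox hx)
          (strictMono_norm_of_mem_divergenceBox hx)

end Divergence

theorem analyticAt_evalAt (p : ℕ) [hp : Fact p.Prime] {N : ℕ} (P : MvPolynomial (Idx N) ℂ)
    (s : Idx N → ℂ) : AnalyticAt ℂ (evalAt p P) s := by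
  have hp0 : (p : ℂ) ≠ 0 := by exact_mod_cast hp.out.ne_zero
  refine AnalyticAt.aeval_mvPolynomial (f := fun (s : Idx N → ℂ) k => (p : ℂ) ^ (-(s k)))
    (fun k => ?_) P
  have hk : AnalyticAt ℂ (fun s : Idx N → ℂ => s k) s :=
    (ContinuousLinearMap.proj (R := ℂ) (φ := fun _ : Idx N => ℂ) k).analyticAt s
  simp only [Complex.cpow_def_of_ne_zero hp0]
  exact (analyticAt_const.mul hk.neg).cexp

end

end KobaNielsen

theorem mainTheorem1 (p : ℕ) [Fact p.Prime] (N : ℕ) (hN : 4 ≤ N) :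
    -- the region of convergence contains a non-empty open connected set
    (IsOpen (KobaNielsen.tube N) ∧ IsConnected (KobaNielsen.tube N) ∧
      KobaNielsen.tube N ⊆ KobaNielsen.regionH N) ∧
    -- the integral converges and is holomorphic there
    (∀ s ∈ KobaNielsen.regionH N, MeasureTheory.IntegrableOn (KobaNielsen.integrand p s)
      (KobaNielsen.Lam p N)ᶜ (KobaNielsen.haarN p N)) ∧
    IsOpen (KobaNielsen.regionH N) ∧
    AnalyticOnNhd ℂ (KobaNielsen.zeta p N) (KobaNielsen.regionH N) ∧
    -- rational continuation and its poles
    (∃ P Q : MvPolynomial (KobaNielsen.Idx N) ℂ,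
      (∀ s ∈ KobaNielsen.regionH N, KobaNielsen.evalAt p Q s ≠ 0 ∧
        KobaNielsen.zeta p N s = KobaNielsen.evalAt p P s / KobaNielsen.evalAt p Q s) ∧
      ∀ s, KobaNielsen.IsPole p P Q s →
        KobaNielsen.rePart s ∈ KobaNielsen.polarHyperplanes N) ∧
    -- divergence to `+∞`
    (∀ s : KobaNielsen.Idx N → ℂ, (∀ k, 0 ≤ (s k).re) →
      ∫⁻ x in (KobaNielsen.Lam p N)ᶜ, ‖KobaNielsen.integrand p s x‖ₑ
        ∂(KobaNielsen.haarN p N) = ⊤) := by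
  obtain ⟨P, Q, hQ, hPQ⟩ := KobaNielsen.zeta_mem_rationalFunctions (p := p) (N := N)
  have hQH : ∀ s ∈ KobaNielsen.regionH N, KobaNielsen.evalAt p Q s ≠ 0 := fun s hs =>
    hQ s (KobaNielsen.notMem_polarHyperplanes hs)
  have hquot : ∀ s, KobaNielsen.evalAt p Q s ≠ 0 →
      AnalyticAt ℂ (fun z => KobaNielsen.evalAt p P z / KobaNielsen.evalAt p Q z) s := fun s hs =>
    (KobaNielsen.analyticAt_evalAt p P s).div (KobaNielsen.analyticAt_evalAt p Q s) hs
  have hzeta : AnalyticOnNhd ℂ (KobaNielsen.zeta p N) (KobaNielsen.regionH N) := fun s hs => by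
    refine (hquot s (hQH s hs)).congr ?_
    filter_upwards [KobaNielsen.isOpen_regionH.mem_nhds hs] with z hz
    exact (hPQ ⟨z, hz⟩).symm
  have hpole : ∀ s, KobaNielsen.IsPole p P Q s →
      KobaNielsen.rePart s ∈ KobaNielsen.polarHyperplanes N := fun s hs => by
    by_contra hpolar
    exact hs ⟨_, hquot s (hQ s hpolar), .of_forall fun _ _ => rfl⟩
  exact ⟨⟨KobaNielsen.isOpen_tube, KobaNielsen.isConnected_tube hN,
    KobaNielsen.tube_subset_regionH hN⟩, fun s hs => KobaNielsen.integrableOn_integrand hs,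
    KobaNielsen.isOpen_regionH, hzeta, ⟨P, Q, fun s hs => ⟨hQH s hs, hPQ ⟨s, hs⟩⟩, hpole⟩,
    fun s hs => KobaNielsen.lintegral_enorm_integrand_eq_top hN hs⟩
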